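/- \textbf{Setting (noninterference).} Let $\mathit{Lock},\mathit{Var}$ be finite types, $\mathit{Val},\mathit{Reg}$ types, $X=\mathit{Lock}\uplus\mathit{Var}$ the shared variables and $\mathit{Mem}=X\to\mathit{Val}$. A \emph{mode state} $mds$ assigns to each of $\mathbf{AsmNoW},\mathbf{AsmNoRW},\mathbf{GuarNoW},\mathbf{GuarNoRW}$ a subset of $X$. A local configuration is a triple $\langle t,mds,mem\rangle$ with thread-private state $t$; a global one is a list $cms$ of pairs $(t,mds)$ with a memory. A step relation $\leadsto$ on local configurations gives $\leadsto_n$ (thread $n$, which must exist, takes one step on the common memory) and $\to_{s}$ for a finite schedule $s$ (a list of thread indices, executed in order). A classification $\mathcal L:\mathit{Mem}\to X\to\{\mathrm{High},\mathrm{Low}\}$ is given; $\mathrm{Cvars}(x)$ is the set of $y$ such that changing the value of $y$ alone can change $\mathcal L(mem)(x)$, and $\mathcal C=\bigcup_x\mathrm{Cvars}(x)$. Write $mem_1=_{\mathrm L}mem_2$ if $mem_1x=mem_2x$ whenever $\mathcal L(mem_1)(x)=\mathrm{Low}$. Call $x$ \emph{readable} in $mds$ if $x\notin mds\,\mathbf{AsmNoRW}$,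 \emph{writable} if $x\notin mds\,\mathbf{AsmNoW}\cup mds\,\mathbf{AsmNoRW}$. Write $mem_1=_{mds}mem_2$ if $mem_1x=mem_2x$ for all $x$ that are in $\mathcal C$ or satisfy $\mathcal L(mem_1)(x)=\mathrm{Low}$ and are readable. A relation $\mathcal B$ on local configurations is a \emph{strong low bisimulation modulo modes} if it is symmetric; if $(\langle t_1,mds,mem_1\rangle,\langle t_2,mds,mem_2\rangle)\in\mathcal B$, every $x$ with $mem_1x\ne mem_1'x$ or $mem_2x\neq mem_2'x$ or $\mathcal L(mem_1)(x)\ne\mathcal L(mem_1')(x)$ is writable in $mds$, and $mem_1'=_{mds}mem_2'$, then $(\langle t_1,mds,mem_1'\rangle,\langle t_2,mds,mem_2'\rangle)\in\mathcal B$; and for $(lc_1,lc_2)\in\mathcal B$ with equal mode state $mds$, the memories are $=_{mds}$, and each $lc_1\leadsto lc_1'$ has some $lc_2\leadsto lc_2'$ with $(lc_1',lc_2')\in\mathcal B$ and equal mode states. $\mathrm{ComSecure}(I,Q)(t,mds)$: for all $mem_1=_{mds}mem_2$ with $I(mem_1),I(mem_2)$ there is a strong low bisimulation modulo modes $\mathcal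 B$ with $Q(\mathcal B)$ and $(\langle t,mds,mem_1\rangle,\langle t,mds,mem_2\rangle)\in\mathcal B$. $\mathrm{SysSecure}(I)(cms)$: for all $mem_1=_{\mathrm L}mem_2$ with $I(mem_1),I(mem_2)$ and all $s$ with $(cms,mem_1)\to_s(cms_1',mem_1')$: some $(cms_2',mem_2')$ satisfies $(cms,mem_2)\to_s(cms_2',mem_2')$; and for every such $(cms_2',mem_2')$ the lists $cms_1',cms_2'$ have the same length and the same list of mode states, and $mem_1'x=mem_2'x$ for every $x$ that is in $\mathcal C$ or satisfies $\mathcal L(mem_1')(x)=\mathrm{Low}$ and is readable in the mode states of all threads. \emph{Local mode compliance} of $lc$: for every $\langle t,mds,mem\rangle$ reachable from $lc$ by steps and by arbitrary changes of memory that alter values and classifications of currently writable variables only, for all $x\in mds\,\mathbf{GuarNoRW}$ no step of $t$ (from any mode state and memory) reads or writes $x$ or a variable of $\mathrm{Cvars}(x)$ (i.e.\ the step remains possible, with the same resulting thread and mode state, when such a variable is set to any $v$ before and after), and for all $x\in mds\,\mathbf{GuarNoW}$ no step of $t$ changes the value or classification of $x$. \textbf{Locks.} Given are a zero of $\mathit{Val}$,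 a predicate $\mathrm{ev}$ on $\mathit{Val}$ and values $\mathsf t,\mathsf f$ with $\mathrm{ev}(\mathsf t)$, $\neg\mathrm{ev}(\mathsf f)$, and maps $\mathrm{NoW},\mathrm{NoRW}:\mathit{Lock}\to\mathcal P(\mathit{Var})$. Assume: variables in $\mathcal C$ are always $\mathrm{Low}$; locks are always $\mathrm{Low}$ and not in $\mathcal C$; if $c\in\mathrm{Cvars}(v)$ then $c\in\mathrm{NoW}(k)\iff v\in\mathrm{NoW}(k)$ and likewise for $\mathrm{NoRW}$; no variable is in $\mathrm{NoW}(k)\cup\mathrm{NoRW}(k)$ for two different $k$; for each $k$ the sets $\mathrm{NoW}(k),\mathrm{NoRW}(k)$ are disjoint and not both empty. Acquiring $k$ sets its value to $\mathsf t$, adds $\mathrm{NoW}(k),\mathrm{NoRW}(k)$ to $\mathbf{AsmNoW},\mathbf{AsmNoRW}$ and removes them from $\mathbf{GuarNoW},\mathbf{GuarNoRW}$, respectively; releasing sets the value to $\mathsf f$ and does the reverse. $\mathrm{NoLocksHeld}(mem)$: $\neg\mathrm{ev}(mem\,k)$ for all $k$. $\mathrm{InitMds}$ has no assumptions and the guarantees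 $\mathbf{GuarNoW}=\bigcup_k\mathrm{NoW}(k)$, $\mathbf{GuarNoRW}=\bigcup_k\mathrm{NoRW}(k)$. \textbf{While.} Expressions: $e::=n\mid v\mid e\oplus e$ with $\oplus:\mathit{Val}\to\mathit{Val}\to\mathit{Val}$. Commands: $\mathsf{Stop}$ (terminated), $\mathsf{Skip}$, $c;c$, $\mathsf{If}\,e\,c\,c$, $\mathsf{While}\,e\,c$, $v:=e$, $\mathsf{LockAcq}\,k$, $\mathsf{LockRel}\,k$; the command is the thread-private state. Steps: $\mathsf{Skip}$, assignment, acquisition of $k$ if $\neg\mathrm{ev}(mem\,k)$, and release of $k$ if the mode state has all the assumptions and none of the guarantees that belong to $k$, lead to $\mathsf{Stop}$; otherwise $\mathsf{LockAcq}$ and $\mathsf{LockRel}$ stutter; $\mathsf{Stop};c$ steps to $c$; $c_1;c_2$ steps with $c_1$; $\mathsf{If}$ steps to its first branch iff $e$ is nonzero, else to its second; $\mathsf{While}\,e\,c$ steps to $\mathsf{If}\,e\,(c;\mathsf{While}\,e\,c)\,\mathsf{Stop}$. $\mathrm{NoHighBranching}(\mathcal B)$: $(\langle c,mds,mem\rangle,\langle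 c',mds,mem'\rangle)\in\mathcal B$ implies $c=c'$ and, if the leftmost command of the sequence $c$ is $\mathsf{If}\,e\,c_1\,c_2$, that $e$ has the same value in $mem$ and $mem'$. \textbf{RISC.} A program text $P$ is a list of instructions $\mathsf{Load}\,r\,v$, $\mathsf{Store}\,v\,r$, $\mathsf{Jmp}\,l$, $\mathsf{Jz}\,l\,r$, $\mathsf{Nop}$, $\mathsf{MoveK}\,r\,n$, $\mathsf{MoveR}\,r\,r'$, $\mathsf{Op}\oplus r\,r'$ ($r:=r\oplus r'$), $\mathsf{LockAcq}\,k$, $\mathsf{LockRel}\,k$, each optionally labelled by a natural number; the thread-private state is $((pc,P),regs)$. Jumps go to the first instruction with the given label, or to the end of $P$ if there is none; there is no step outside $P$; lock instructions act as in While, leaving $pc$ unchanged when they stutter. \textbf{Compiler.} A \emph{compilation record} is $C=(\Phi,\mathcal S)$ with $\Phi:\mathit{Reg}\rightharpoonup\text{expressions}$ and $\mathcal S=(\mathcal S_1,\mathcal S_2)$ a pair of subsets of $\mathit{Var}$ (variables assumed $\mathbf{AsmNoW}$, $\mathbf{AsmNoRW}$); $\mathrm{InitComprec}$ is the empty record.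 $v$ is \emph{stable} if $v$ and its control variables lie in $\mathcal S_1\cup\mathcal S_2$. Given is a register allocation scheme: partial functions $\mathrm{alloc}(\Phi,A)$ and $\mathrm{cached}(\Phi,A,v)$ that return a register outside $A$, the latter one with $\Phi(r)=v$. $\mathrm{CompileExpr}\ C\ A\ l\ e$ returns code (the label $l$, if any, on its first instruction), a result register and a record. Constant $n$: $\mathsf{MoveK}$ into an allocated register. Variable: nothing if cached, else $\mathsf{Load}$ into an allocated register. $e_1\oplus e_2$: code for $e_1$ with result $r_1$, code for $e_2$ with $A\cup\{r_1\}$ and result $r_2$, $\mathsf{Op}\oplus r_1\,r_2$, result $r_1$. $\Phi$ is updated to map each written register to the expression it now holds. It fails if allocation fails. $(PCs,l',nl',C',\mathit{failed})=\mathrm{CompileCmd}\ C\ l\ nl\ c$, where $l$ is an optional label for the first instruction, $nl,nl'$ are next unused labels, $l'$ is an optional label for what follows, and $PCs$ is a list of instructions each annotated with the record before it: $\mathsf{Skip}$: $\mathsf{Nop}$. Sequence: consecutive compilation, concatenated. $\mathsf{LockAcq}\,k$: the lock instruction, adding $\mathrm{NoW}(k),\mathrm{NoRW}(k)$ to $\mathcal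 S$. $\mathsf{LockRel}\,k$: the lock instruction, removing them and dropping entries of $\Phi$ that mention a variable not stable afterwards. $v:=e$: code for $e$ (with $A=\emptyset$), then $\mathsf{Store}$, dropping entries that mention $v$. $\mathsf{If}\,e\,c_1\,c_2$: code for $e$ giving $r$ and $C_1$; $\mathsf{Jz}\,nl\,r$; code $P_1$ for $c_1$ compiled from $C_1$ with no label and next label $nl+2$; $\mathsf{Jmp}\,(nl+1)$; code $P_2$ for $c_2$ compiled from $C_1$ with label $nl$; $\mathsf{Nop}$; $l'=nl+1$; the final $\Phi$ keeps the entries on which both branches agree, and the final $\mathcal S$ is that after $c_1$. $\mathsf{While}\,e\,c$: $\Phi$ is emptied; code for $e$ giving $r$ and $C_1$, with head label $l$ (fresh if absent); $\mathsf{Jz}$ on $r$ to a fresh exit label; code for $c$ from $C_1$; $\mathsf{Jmp}$ to the head label; $l'$ is the exit label and the final record is $C_1$. The instruction after a subprogram carries the label $l'$ returned by the latter. $\mathit{failed}$ is true iff $\mathsf{Stop}$ is compiled, a call of $\mathrm{CompileExpr}$ fails, or $\mathrm{CompilerInputReqs}\ C\ l\ nl\ c$ is violated. $\mathrm{CompilerInputReqs}\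 C\ l\ nl\ c$: $c\neq\mathsf{Stop}$; $l$, if present, is $<nl$; all variables mentioned in $\Phi$ are stable; and, tracking $\mathcal S$ through $c$, all expressions in $c$ mention only stable variables, each assigned variable is stable or governed by no lock, the two branches of a conditional end with the same $\mathcal S$, and loop bodies restore $\mathcal S$. \textbf{Theorem.} Let $cs$ be a list of While commands and $cms_r$ a list, of the same length, of pairs of a RISC thread-private state and a mode state. Suppose that for each index $i$ there are $l,nl,PCs,l',nl',C',regs$ such that \begin{itemize} \item $\mathrm{ComSecure}(\mathrm{NoLocksHeld},\mathrm{NoHighBranching})\,(cs[i],\mathrm{InitMds})$; \item $\langle cs[i],\mathrm{InitMds},mem\rangle$ is locally mode compliant for each $mem$ with $\mathrm{NoLocksHeld}(mem)$; \item $(PCs,l',nl',C',\mathrm{False})=\mathrm{CompileCmd}\ \mathrm{InitComprec}\ l\ nl\ cs[i]$ and $\mathrm{CompilerInputReqs}\ \mathrm{InitComprec}\ l\ nl\ cs[i]$; \item $cms_r[i]=(((0,\mathrm{map}\ \mathrm{fst}\ PCs),regs),\mathrm{InitMds})$. \end{itemize} Then $\mathrm{SysSecure}(\mathrm{NoLocksHeld})(cms_r)$.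 -/

import Mathlib

namespace Covern

/-! ### Concurrent value-dependent noninterference, for an arbitrary thread language

`T` is the type of thread-private states, `X` the type of shared variables and `V` the type of
values.  A shared memory is a total map `X → V`. -/

/-- Assume-guarantee modes. -/
inductive Mode
  | asmNoW | asmNoRW | guarNoW | guarNoRW

/-- Sensitivity levels. -/
inductive Sec
  | high | low

/-- Mode states. -/
abbrev Mds (X : Type*) := Mode → Set X

/-- Local configurations: thread-private state, mode state, shared memory. -/
@[ext]
structure LocalConf (T X V : Type*) where
  tps : T
  mds : Mds X
  mem : X → V

/-- Global configurations: the list of the threads' private and mode states, and the memory. -/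
abbrev GlobalConf (T X V : Type*) := List (T × Mds X) × (X → V)

/-- One-step evaluation relations on local configurations. -/
abbrev Eval (T X V : Type*) := LocalConf T X V → LocalConf T X V → Prop

section Theory

variable {T X V : Type*}

/-- `mem` with the value of `x` replaced by `v`. -/
noncomputable def upd {X V : Type*} (mem : X → V) (x : X) (v : V) : X → V :=
  open Classical in Function.update mem x v

/-- The control variables of `x`: those variables whose value can affect the classification
of `x`. -/
def Cvars (dma : (X → V) → X → Sec) (x : X) : Set X :=
  {y | ∃ mem v, dma (upd mem y v) x ≠ dma mem x}

/-- All control variables. -/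
def Cset (dma : (X → V) → X → Sec) : Set X := {y | ∃ x, y ∈ Cvars dma x}

def LowEq (dma : (X → V) → X → Sec) (mem₁ mem₂ : X → V) : Prop :=
  ∀ x, dma mem₁ x = Sec.low → mem₁ x = mem₂ x

def Readable (mds : Mds X) (x : X) : Prop := x ∉ mds Mode.asmNoRW

def Writable (mds : Mds X) (x : X) : Prop := x ∉ mds Mode.asmNoW ∧ x ∉ mds Mode.asmNoRW

/-- Low-equivalence of memories modulo a mode state. -/
def LowEqMod (dma : (X → V) → X → Sec) (mds : Mds X) (mem₁ mem₂ : X → V) : Prop :=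
  ∀ x, x ∈ Cset dma ∨ (dma mem₁ x = Sec.low ∧ Readable mds x) → mem₁ x = mem₂ x

/-- Closedness under globally consistent changes. -/
def CgConsistent (dma : (X → V) → X → Sec)
    (B : LocalConf T X V → LocalConf T X V → Prop) : Prop :=
  ∀ (tps₁ : T) (mem₁ : X → V) (tps₂ : T) (mem₂ : X → V) (mds : Mds X),
    B ⟨tps₁, mds, mem₁⟩ ⟨tps₂, mds, mem₂⟩ →
    ∀ mem₁' mem₂' : X → V,
      (∀ x, (mem₁ x ≠ mem₁' x ∨ mem₂ x ≠ mem₂' x ∨ dma mem₁ x ≠ dma mem₁' x) →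
        Writable mds x) ∧ LowEqMod dma mds mem₁' mem₂' →
      B ⟨tps₁, mds, mem₁'⟩ ⟨tps₂, mds, mem₂'⟩

/-- Strong low bisimulations modulo modes. -/
def StrongLowBisimMM (dma : (X → V) → X → Sec) (eval : Eval T X V)
    (B : LocalConf T X V → LocalConf T X V → Prop) : Prop :=
  CgConsistent dma B ∧ (∀ lc₁ lc₂, B lc₁ lc₂ → B lc₂ lc₁) ∧
  ∀ lc₁ lc₂, B lc₁ lc₂ ∧ lc₁.mds = lc₂.mds →
    LowEqMod dma lc₁.mds lc₁.mem lc₂.mem ∧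
    ∀ lc₁', eval lc₁ lc₁' → ∃ lc₂', eval lc₂ lc₂' ∧ lc₁'.mds = lc₂'.mds ∧ B lc₁' lc₂'

/-- Per-thread compositional security, with initial-memory requirement `init` and bisimulation
requirement `reqs`. -/
def ComSecure (dma : (X → V) → X → Sec) (eval : Eval T X V) (init : (X → V) → Prop)
    (reqs : (LocalConf T X V → LocalConf T X V → Prop) → Prop) (cm : T × Mds X) : Prop :=
  ∀ mem₁ mem₂ : X → V, LowEqMod dma cm.2 mem₁ mem₂ ∧ init mem₁ ∧ init mem₂ →
    ∃ B, StrongLowBisimMM dma eval B ∧ reqs B ∧ B ⟨cm.1, cm.2, mem₁⟩ ⟨cm.1, cm.2, mem₂⟩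

/-- The `n`th thread of a global configuration takes one step. -/
def SchedStep (eval : Eval T X V) (n : ℕ) (gc gc' : GlobalConf T X V) : Prop :=
  ∃ (h : n < gc.1.length) (tps' : T) (mds' : Mds X) (mem' : X → V),
    eval ⟨(gc.1[n]).1, (gc.1[n]).2, gc.2⟩ ⟨tps', mds', mem'⟩ ∧
    gc' = (gc.1.set n (tps', mds'), mem')

/-- Evaluation of a global configuration according to a schedule. -/
def EvalSched (eval : Eval T X V) : List ℕ → GlobalConf T X V → GlobalConf T X V → Prop
  | [], gc, gc' => gc = gc'
  | n :: ns, gc, gc' => ∃ gc'', SchedStep eval n gc gc'' ∧ EvalSched eval ns gc'' gc'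

/-- Whole-system value-dependent security, with initial-memory requirement `init`. -/
def SysSecure (dma : (X → V) → X → Sec) (eval : Eval T X V) (init : (X → V) → Prop)
    (cms : List (T × Mds X)) : Prop :=
  ∀ mem₁ mem₂ : X → V, init mem₁ ∧ init mem₂ ∧ LowEq dma mem₁ mem₂ →
    ∀ (sched : List ℕ) (cms₁' : List (T × Mds X)) (mem₁' : X → V),
      EvalSched eval sched (cms, mem₁) (cms₁', mem₁') →
      (∃ cms₂' mem₂', EvalSched eval sched (cms, mem₂) (cms₂', mem₂')) ∧
      ∀ (cms₂' : List (T × Mds X)) (mem₂' : X → V),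
        EvalSched eval sched (cms, mem₂) (cms₂', mem₂') →
        cms₁'.length = cms₂'.length ∧
        cms₁'.map Prod.snd = cms₂'.map Prod.snd ∧
        ∀ x, x ∈ Cset dma ∨ (dma mem₁' x = Sec.low ∧ ∀ cm ∈ cms₁', Readable cm.2 x) →
          mem₁' x = mem₂' x

/-- Local reachability: a thread's own steps, interleaved with arbitrary changes by others to
variables that the current mode state lets them write. -/
inductive LocReach (dma : (X → V) → X → Sec) (eval : Eval T X V) (lc : LocalConf T X V) :
    LocalConf T X V → Prop
  | refl : LocReach dma eval lc lc
  | step {lc' lc'' : LocalConf T X V} :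
      LocReach dma eval lc lc' → eval lc' lc'' → LocReach dma eval lc lc''
  | memDiff {tps : T} {mds : Mds X} {mem mem' : X → V} :
      LocReach dma eval lc ⟨tps, mds, mem⟩ →
      (∀ x, mem x ≠ mem' x ∨ dma mem x ≠ dma mem' x → Writable mds x) →
      LocReach dma eval lc ⟨tps, mds, mem'⟩

/-- No next step of the thread-private state `c` reads or writes `x` or any of its control
variables. -/
def DoesntRW (dma : (X → V) → X → Sec) (eval : Eval T X V) (c : T) (x : X) : Prop :=
  ∀ (mds : Mds X) (mem : X → V) (c' : T) (mds' : Mds X) (mem' : X → V),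
    eval ⟨c, mds, mem⟩ ⟨c', mds', mem'⟩ →
    ∀ y, y = x ∨ y ∈ Cvars dma x → ∀ v : V, eval ⟨c, mds, upd mem y v⟩ ⟨c', mds', upd mem' y v⟩

/-- No next step of the thread-private state `c` changes the value or the classification of
`x`. -/
def DoesntW (dma : (X → V) → X → Sec) (eval : Eval T X V) (c : T) (x : X) : Prop :=
  ∀ (mds : Mds X) (mem : X → V) (c' : T) (mds' : Mds X) (mem' : X → V),
    eval ⟨c, mds, mem⟩ ⟨c', mds', mem'⟩ → mem x = mem' x ∧ dma mem x = dma mem' x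

def RespectsOwnGuars (dma : (X → V) → X → Sec) (eval : Eval T X V) (c : T) (mds : Mds X) :
    Prop :=
  ∀ x, (x ∈ mds Mode.guarNoRW → DoesntRW dma eval c x) ∧
    (x ∈ mds Mode.guarNoW → DoesntW dma eval c x)

/-- Local mode compliance. -/
def LocalModeUse (dma : (X → V) → X → Sec) (eval : Eval T X V) (lc : LocalConf T X V) : Prop :=
  ∀ lc', LocReach dma eval lc lc' → RespectsOwnGuars dma eval lc'.tps lc'.mds

end Theory

/-! ### The locking discipline

Shared variables are lock variables (`Sum.inl k`) or program variables (`Sum.inr v`). -/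

/-- The parameters that the developer supplies: the zero of the value type, tested by conditionals;
the encoding of lock states as values; the lock interpretation; the classification function. -/
structure Setup (Lock Var Val : Type*) where
  zero : Val
  evLock : Val → Prop
  lockTrue : Val
  lockFalse : Val
  /-- variables to which holding the lock gives exclusive write access -/
  noW : Lock → Set Var
  /-- variables to which holding the lock gives exclusive read and write access -/
  noRW : Lock → Set Var
  dma : (Lock ⊕ Var → Val) → Lock ⊕ Var → Sec

/-- The standing restrictions on the parameters. -/
structure Setup.WellFormed {Lock Var Val : Type*} (S : Setup Lock Var Val) : Prop where
  evLock_lockTrue : S.evLock S.lockTrue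
  not_evLock_lockFalse : ¬ S.evLock S.lockFalse
  /-- control variables are statically low -/
  control_low : ∀ mem, ∀ x ∈ Cset S.dma, S.dma mem x = Sec.low
  lock_not_control : ∀ k, Sum.inl k ∉ Cset S.dma
  lock_low : ∀ k mem, S.dma mem (Sum.inl k) = Sec.low
  control_same_lock : ∀ (c v : Var) (k : Lock), Sum.inr c ∈ Cvars S.dma (Sum.inr v) →
    (c ∈ S.noW k ↔ v ∈ S.noW k) ∧ (c ∈ S.noRW k ↔ v ∈ S.noRW k)
  managed_once : ∀ (v : Var) (k k' : Lock), v ∈ S.noW k ∪ S.noRW k →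
    v ∈ S.noW k' ∪ S.noRW k' → k' = k
  not_vacuous : ∀ k, S.noW k ∪ S.noRW k ≠ ∅
  disjoint : ∀ k, S.noW k ∩ S.noRW k = ∅

section Locks

variable {Lock Var Val : Type*} (S : Setup Lock Var Val)

/-- Effect on the mode state of acquiring lock `k`. -/
def lockAcqUpd (mds : Mds (Lock ⊕ Var)) (k : Lock) : Mds (Lock ⊕ Var)
  | Mode.guarNoW => mds Mode.guarNoW \ Sum.inr '' S.noW k
  | Mode.asmNoW => mds Mode.asmNoW ∪ Sum.inr '' S.noW k
  | Mode.guarNoRW => mds Mode.guarNoRW \ Sum.inr '' S.noRW k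
  | Mode.asmNoRW => mds Mode.asmNoRW ∪ Sum.inr '' S.noRW k

/-- Effect on the mode state of releasing lock `k`. -/
def lockRelUpd (mds : Mds (Lock ⊕ Var)) (k : Lock) : Mds (Lock ⊕ Var)
  | Mode.guarNoW => mds Mode.guarNoW ∪ Sum.inr '' S.noW k
  | Mode.asmNoW => mds Mode.asmNoW \ Sum.inr '' S.noW k
  | Mode.guarNoRW => mds Mode.guarNoRW ∪ Sum.inr '' S.noRW k
  | Mode.asmNoRW => mds Mode.asmNoRW \ Sum.inr '' S.noRW k

/-- The mode state is consistent with holding lock `k`. -/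
def LockHeldMdsCorrect (mds : Mds (Lock ⊕ Var)) (k : Lock) : Prop :=
  ∀ x : Var, (x ∈ S.noW k → Sum.inr x ∉ mds Mode.guarNoW ∧ Sum.inr x ∈ mds Mode.asmNoW) ∧
    (x ∈ S.noRW k → Sum.inr x ∉ mds Mode.guarNoRW ∧ Sum.inr x ∈ mds Mode.asmNoRW)

def NoLocksHeld (mem : Lock ⊕ Var → Val) : Prop := ∀ k, ¬ S.evLock (mem (Sum.inl k))

def initMds : Mds (Lock ⊕ Var)
  | Mode.guarNoW => Sum.inr '' ⋃ k, S.noW k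
  | Mode.guarNoRW => Sum.inr '' ⋃ k, S.noRW k
  | Mode.asmNoW => ∅
  | Mode.asmNoRW => ∅

end Locks

/-! ### The source language -/

/-- Expressions: constants, program variables, binary operators. -/
inductive Exp (Var Val : Type*)
  | const (n : Val)
  | var (v : Var)
  | op (o : Val → Val → Val) (e₁ e₂ : Exp Var Val)

namespace Exp

variable {Lock Var Val : Type*}

def vars : Exp Var Val → Set Var
  | const _ => ∅
  | var v => {v}
  | op _ e₁ e₂ => vars e₁ ∪ vars e₂

def ev (mem : Lock ⊕ Var → Val) : Exp Var Val → Val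
  | const n => n
  | var v => mem (Sum.inr v)
  | op o e₁ e₂ => o (ev mem e₁) (ev mem e₂)

end Exp

/-- While commands; `halt` is the terminated program. -/
inductive Cmd (Lock Var Val : Type*)
  | halt
  | skip
  | seq (c₁ c₂ : Cmd Lock Var Val)
  | ite (e : Exp Var Val) (c₁ c₂ : Cmd Lock Var Val)
  | whileDo (e : Exp Var Val) (c : Cmd Lock Var Val)
  | assign (v : Var) (e : Exp Var Val)
  | lockAcq (k : Lock)
  | lockRel (k : Lock)

/-- The leftmost command in a sequence. -/
def Cmd.leftmost {Lock Var Val : Type*} : Cmd Lock Var Val → Cmd Lock Var Val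
  | .seq c₁ _ => c₁.leftmost
  | c => c

/-- Small-step semantics of While. -/
inductive EvalWhile {Lock Var Val : Type*} (S : Setup Lock Var Val) :
    Eval (Cmd Lock Var Val) (Lock ⊕ Var) Val
  | skip (mds mem) : EvalWhile S ⟨.skip, mds, mem⟩ ⟨.halt, mds, mem⟩
  | assign (v e mds mem) :
      EvalWhile S ⟨.assign v e, mds, mem⟩ ⟨.halt, mds, upd mem (Sum.inr v) (e.ev mem)⟩
  | seqStop (c mds mem) : EvalWhile S ⟨.seq .halt c, mds, mem⟩ ⟨c, mds, mem⟩
  | seq (c₁ c₁' c₂ mds mds' mem mem') :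
      EvalWhile S ⟨c₁, mds, mem⟩ ⟨c₁', mds', mem'⟩ →
      EvalWhile S ⟨.seq c₁ c₂, mds, mem⟩ ⟨.seq c₁' c₂, mds', mem'⟩
  | iteTrue (e c₁ c₂ mds mem) : e.ev mem ≠ S.zero →
      EvalWhile S ⟨.ite e c₁ c₂, mds, mem⟩ ⟨c₁, mds, mem⟩
  | iteFalse (e c₁ c₂ mds mem) : e.ev mem = S.zero →
      EvalWhile S ⟨.ite e c₁ c₂, mds, mem⟩ ⟨c₂, mds, mem⟩
  | whileDo (e c mds mem) :
      EvalWhile S ⟨.whileDo e c, mds, mem⟩ ⟨.ite e (.seq c (.whileDo e c)) .halt, mds, mem⟩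
  | lockAcq (k mds mem) : ¬ S.evLock (mem (Sum.inl k)) →
      EvalWhile S ⟨.lockAcq k, mds, mem⟩
        ⟨.halt, lockAcqUpd S mds k, upd mem (Sum.inl k) S.lockTrue⟩
  | lockSpin (k mds mem) : S.evLock (mem (Sum.inl k)) →
      EvalWhile S ⟨.lockAcq k, mds, mem⟩ ⟨.lockAcq k, mds, mem⟩
  | lockRel (k mds mem) : LockHeldMdsCorrect S mds k →
      EvalWhile S ⟨.lockRel k, mds, mem⟩
        ⟨.halt, lockRelUpd S mds k, upd mem (Sum.inl k) S.lockFalse⟩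
  | lockInvalid (k mds mem) : ¬ LockHeldMdsCorrect S mds k →
      EvalWhile S ⟨.lockRel k, mds, mem⟩ ⟨.lockRel k, mds, mem⟩

/-- The ban on branching on high values. -/
def NoHighBranching {Lock Var Val : Type*}
    (B : LocalConf (Cmd Lock Var Val) (Lock ⊕ Var) Val →
      LocalConf (Cmd Lock Var Val) (Lock ⊕ Var) Val → Prop) : Prop :=
  ∀ (c c' : Cmd Lock Var Val) (mds : Mds (Lock ⊕ Var)) (mem mem' : Lock ⊕ Var → Val),
    B ⟨c, mds, mem⟩ ⟨c', mds, mem'⟩ → c = c' ∧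
      ∀ e c₁ c₂, c.leftmost = .ite e c₁ c₂ → e.ev mem = e.ev mem'

/-! ### The target language -/

/-- RISC instructions, without their label.  Labels are natural numbers. -/
inductive RiscOp (Lock Var Val Reg : Type*)
  | load (r : Reg) (v : Var)
  | store (v : Var) (r : Reg)
  | jmp (l : ℕ)
  | jz (l : ℕ) (r : Reg)
  | nop
  | moveK (r : Reg) (n : Val)
  | moveR (r r' : Reg)
  | op (o : Val → Val → Val) (r r' : Reg)
  | lockAcq (k : Lock)
  | lockRel (k : Lock)

/-- Optionally labelled RISC instructions. -/
abbrev Instr (Lock Var Val Reg : Type*) := Option ℕ × RiscOp Lock Var Val Reg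

/-- The thread-private state of a RISC thread: `((pc, program text), register bank)`. -/
abbrev RiscState (Lock Var Val Reg : Type*) :=
  (ℕ × List (Instr Lock Var Val Reg)) × (Reg → Val)

/-- The position of the first instruction labelled `l`; it is the position after the last
instruction if there is none. -/
def resolve {Lock Var Val Reg : Type*} (P : List (Instr Lock Var Val Reg)) (l : ℕ) : ℕ :=
  P.findIdx fun i => i.1 == some l

/-- Small-step semantics of RISC.  In each rule `P[pc]? = some (l, b)` says that `b` is the
instruction at the program counter; there is no step from outside the program text. -/
inductive EvalRisc {Lock Var Val Reg : Type*} (S : Setup Lock Var Val) :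
    Eval (RiscState Lock Var Val Reg) (Lock ⊕ Var) Val
  | load (pc P regs mds mem l r v) : P[pc]? = some (l, .load r v) →
      EvalRisc S ⟨((pc, P), regs), mds, mem⟩
        ⟨((pc + 1, P), upd regs r (mem (Sum.inr v))), mds, mem⟩
  | store (pc P regs mds mem l v r) : P[pc]? = some (l, .store v r) →
      EvalRisc S ⟨((pc, P), regs), mds, mem⟩
        ⟨((pc + 1, P), regs), mds, upd mem (Sum.inr v) (regs r)⟩
  | jmp (pc P regs mds mem l t) : P[pc]? = some (l, .jmp t) →
      EvalRisc S ⟨((pc, P), regs), mds, mem⟩ ⟨((resolve P t, P), regs), mds, mem⟩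
  | jzTaken (pc P regs mds mem l t r) : P[pc]? = some (l, .jz t r) → regs r = S.zero →
      EvalRisc S ⟨((pc, P), regs), mds, mem⟩ ⟨((resolve P t, P), regs), mds, mem⟩
  | jzNotTaken (pc P regs mds mem l t r) : P[pc]? = some (l, .jz t r) → regs r ≠ S.zero →
      EvalRisc S ⟨((pc, P), regs), mds, mem⟩ ⟨((pc + 1, P), regs), mds, mem⟩
  | nop (pc P regs mds mem l) : P[pc]? = some (l, .nop) →
      EvalRisc S ⟨((pc, P), regs), mds, mem⟩ ⟨((pc + 1, P), regs), mds, mem⟩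
  | moveK (pc P regs mds mem l r n) : P[pc]? = some (l, .moveK r n) →
      EvalRisc S ⟨((pc, P), regs), mds, mem⟩ ⟨((pc + 1, P), upd regs r n), mds, mem⟩
  | moveR (pc P regs mds mem l r r') : P[pc]? = some (l, .moveR r r') →
      EvalRisc S ⟨((pc, P), regs), mds, mem⟩ ⟨((pc + 1, P), upd regs r (regs r')), mds, mem⟩
  | op (pc P regs mds mem l o r r') : P[pc]? = some (l, .op o r r') →
      EvalRisc S ⟨((pc, P), regs), mds, mem⟩
        ⟨((pc + 1, P), upd regs r (o (regs r) (regs r'))), mds, mem⟩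
  | lockAcq (pc P regs mds mem l k) : P[pc]? = some (l, .lockAcq k) →
      ¬ S.evLock (mem (Sum.inl k)) →
      EvalRisc S ⟨((pc, P), regs), mds, mem⟩
        ⟨((pc + 1, P), regs), lockAcqUpd S mds k, upd mem (Sum.inl k) S.lockTrue⟩
  | lockSpin (pc P regs mds mem l k) : P[pc]? = some (l, .lockAcq k) →
      S.evLock (mem (Sum.inl k)) →
      EvalRisc S ⟨((pc, P), regs), mds, mem⟩ ⟨((pc, P), regs), mds, mem⟩
  | lockRel (pc P regs mds mem l k) : P[pc]? = some (l, .lockRel k) →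
      LockHeldMdsCorrect S mds k →
      EvalRisc S ⟨((pc, P), regs), mds, mem⟩
        ⟨((pc + 1, P), regs), lockRelUpd S mds k, upd mem (Sum.inl k) S.lockFalse⟩
  | lockInvalid (pc P regs mds mem l k) : P[pc]? = some (l, .lockRel k) →
      ¬ LockHeldMdsCorrect S mds k →
      EvalRisc S ⟨((pc, P), regs), mds, mem⟩ ⟨((pc, P), regs), mds, mem⟩

/-! ### The compiler -/

/-- Register records: what is known about the contents of registers. -/
abbrev RegRec (Var Val Reg : Type*) := Reg → Option (Exp Var Val)

/-- Assumption records: the variables with an `asmNoW`, respectively `asmNoRW`, assumption. -/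
abbrev AsmRec (Var : Type*) := Set Var × Set Var

/-- Compilation records. -/
abbrev CompRec (Var Val Reg : Type*) := RegRec Var Val Reg × AsmRec Var

/-- RISC instructions, each annotated with the compilation record that holds before it. -/
abbrev AnnInstr (Lock Var Val Reg : Type*) := Instr Lock Var Val Reg × CompRec Var Val Reg

/-- A register allocation scheme.  The set `A` holds the registers still needed by the expression
under evaluation.  Both functions may fail; neither may return a register in `A`. -/
structure RegAlloc (Var Val Reg : Type*) where
  /-- choose a register to be overwritten -/
  alloc : RegRec Var Val Reg → Set Reg → Option Reg
  /-- find a register that is recorded as holding the given variable -/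
  cached : RegRec Var Val Reg → Set Reg → Var → Option Reg
  alloc_notMem : ∀ Φ A r, alloc Φ A = some r → r ∉ A
  cached_notMem : ∀ Φ A v r, cached Φ A v = some r → r ∉ A
  cached_eq : ∀ Φ A v r, cached Φ A v = some r → Φ r = some (.var v)

section Compiler

variable {Lock Var Val Reg : Type*}

/-- The empty compilation record. -/
def initCompRec : CompRec Var Val Reg := (fun _ => none, (∅, ∅))

/-- The variable `v` and all its control variables are recorded as not writable by others. -/
def VarStable (S : Setup Lock Var Val) (R : AsmRec Var) (v : Var) : Prop :=
  v ∈ R.1 ∪ R.2 ∧ ∀ v', Sum.inr v' ∈ Cvars S.dma (Sum.inr v) → v' ∈ R.1 ∪ R.2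

/-- The register record mentions only stable variables. -/
def RegrecStable (S : Setup Lock Var Val) (C : CompRec Var Val Reg) : Prop :=
  ∀ r e, C.1 r = some e → ∀ v ∈ e.vars, VarStable S C.2 v

/-- The assumption record after a command, if it terminates. -/
def asmAfter (S : Setup Lock Var Val) : Cmd Lock Var Val → AsmRec Var → AsmRec Var
  | .seq c₁ c₂, R => asmAfter S c₂ (asmAfter S c₁ R)
  | .ite _ c₁ _, R => asmAfter S c₁ R
  | .lockAcq k, R => (R.1 ∪ S.noW k, R.2 ∪ S.noRW k)
  | .lockRel k, R => (R.1 \ S.noW k, R.2 \ S.noRW k)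
  | _, R => R

/-- The static checks on the source command, relative to the assumption record `R`: expressions
mention only stable variables; an assigned variable is stable or not governed by any lock; both
branches of a conditional end with the same assumptions; a loop body restores them. -/
def asmChecks (S : Setup Lock Var Val) : Cmd Lock Var Val → AsmRec Var → Prop
  | .seq c₁ c₂, R => asmChecks S c₁ R ∧ asmChecks S c₂ (asmAfter S c₁ R)
  | .ite e c₁ c₂, R => (∀ v ∈ e.vars, VarStable S R v) ∧ asmChecks S c₁ R ∧ asmChecks S c₂ R ∧
      asmAfter S c₁ R = asmAfter S c₂ R
  | .whileDo e c, R => (∀ v ∈ e.vars, VarStable S R v) ∧ asmChecks S c R ∧ asmAfter S c R = R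
  | .assign v e, R => (∀ x ∈ e.vars, VarStable S R x) ∧
      (VarStable S R v ∨ ∀ k, v ∉ S.noW k ∪ S.noRW k)
  | _, _ => True

def StabilityChecks (S : Setup Lock Var Val) (c : Cmd Lock Var Val) (C : CompRec Var Val Reg) :
    Prop :=
  asmChecks S c C.2

/-- Requirements on the inputs of the compiler. -/
def CompilerInputReqs (S : Setup Lock Var Val) (C : CompRec Var Val Reg) (l : Option ℕ) (nl : ℕ)
    (c : Cmd Lock Var Val) : Prop :=
  StabilityChecks S c C ∧ RegrecStable S C ∧ c ≠ .halt ∧ ∀ x, l = some x → x < nl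

open Classical in
/-- Keep only the entries of the register record whose expression satisfies `p`. -/
noncomputable def RegRec.filter (Φ : RegRec Var Val Reg) (p : Exp Var Val → Prop) :
    RegRec Var Val Reg :=
  fun r => (Φ r).filter fun e => decide (p e)

open Classical in
/-- The entries on which two register records agree. -/
noncomputable def RegRec.meet (Φ Φ' : RegRec Var Val Reg) : RegRec Var Val Reg :=
  fun r => if Φ r = Φ' r then Φ r else none

/-- The expression compiler: returns the annotated program that evaluates the expression, the
register that holds its value, and the resulting compilation record; `none` means failure of
register allocation.  The label `l`, if any, goes to the first instruction produced. -/
noncomputable def compileExpr (ra : RegAlloc Var Val Reg) :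
    CompRec Var Val Reg → Set Reg → Option ℕ → Exp Var Val →
    Option (List (AnnInstr Lock Var Val Reg) × Reg × CompRec Var Val Reg)
  | C, A, l, .const n =>
    match ra.alloc C.1 A with
    | none => none
    | some r => some ([((l, .moveK r n), C)], r, (upd C.1 r (some (.const n)), C.2))
  | C, A, l, .var v =>
    match ra.cached C.1 A v with
    | some r => some ([], r, C)
    | none =>
      match ra.alloc C.1 A with
      | none => none
      | some r => some ([((l, .load r v), C)], r, (upd C.1 r (some (.var v)), C.2))
  | C, A, l, .op o e₁ e₂ =>
    match compileExpr ra C A l e₁ with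
    | none => none
    | some (P₁, r₁, C₁) =>
      match compileExpr ra C₁ (A ∪ {r₁}) (if P₁.isEmpty then l else none) e₂ with
      | none => none
      | some (P₂, r₂, C₂) =>
        some (P₁ ++ P₂ ++
            [((if (P₁ ++ P₂).isEmpty then l else none, .op o r₁ r₂), C₂)],
          r₁, (upd C₂.1 r₁ (some (.op o e₁ e₂)), C₂.2))

/-- Code generation.  The input is a compilation record, an optional label for the first
instruction, the next unused label and a command; the output is the annotated program, an optional
label for the instruction that comes next, the next unused label, the final compilation record, and
a failure flag. -/
noncomputable def compileCore (S : Setup Lock Var Val) (ra : RegAlloc Var Val Reg) :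
    CompRec Var Val Reg → Option ℕ → ℕ → Cmd Lock Var Val →
    List (AnnInstr Lock Var Val Reg) × Option ℕ × ℕ × CompRec Var Val Reg × Bool
  | C, _, nl, .halt => ([], none, nl, C, true)
  | C, l, nl, .skip => ([((l, .nop), C)], none, nl, C, false)
  | C, l, nl, .seq c₁ c₂ =>
    let (P₁, l₁, nl₁, C₁, f₁) := compileCore S ra C l nl c₁
    let (P₂, l₂, nl₂, C₂, f₂) := compileCore S ra C₁ l₁ nl₁ c₂
    (P₁ ++ P₂, l₂, nl₂, C₂, f₁ || f₂)
  | C, l, nl, .ite e c₁ c₂ =>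
    match compileExpr ra C ∅ l e with
    | none => ([], none, nl, C, true)
    | some (Pe, r, C₁) =>
      let br := nl
      let ex := nl + 1
      let (P₁, l₁, nl₁, C₂, f₁) := compileCore S ra C₁ none (nl + 2) c₁
      let (P₂, l₂, nl₂, C₃, f₂) := compileCore S ra C₁ (some br) nl₁ c₂
      (Pe ++ [((if Pe.isEmpty then l else none, .jz br r), C₁)] ++ P₁ ++
          [((l₁, .jmp ex), C₂)] ++ P₂ ++ [((l₂, .nop), C₃)],
        some ex, nl₂, (RegRec.meet C₂.1 C₃.1, C₂.2), f₁ || f₂)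
  | C, l, nl, .whileDo e c =>
    -- the loop head keeps the label `l` if there is one, and the register record is emptied there
    let lp := l.getD nl
    let ex := if l.isSome then nl else nl + 1
    let C₀ : CompRec Var Val Reg := (fun _ => none, C.2)
    match compileExpr ra C₀ ∅ (some lp) e with
    | none => ([], none, nl, C, true)
    | some (Pe, r, C₁) =>
      let (P₁, l₁, nl₁, C₂, f₁) := compileCore S ra C₁ none (ex + 1) c
      (Pe ++ [((if Pe.isEmpty then some lp else none, .jz ex r), C₁)] ++ P₁ ++
          [((l₁, .jmp lp), C₂)],
        some ex, nl₁, C₁, f₁)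
  | C, l, nl, .assign v e =>
    match compileExpr ra C ∅ l e with
    | none => ([], none, nl, C, true)
    | some (Pe, r, C₁) =>
      -- entries that mention the assigned variable are dropped
      (Pe ++ [((if Pe.isEmpty then l else none, .store v r), C₁)],
        none, nl, (RegRec.filter C₁.1 fun e' => v ∉ e'.vars, C₁.2), false)
  | C, l, nl, .lockAcq k =>
    ([((l, .lockAcq k), C)], none, nl, (C.1, (C.2.1 ∪ S.noW k, C.2.2 ∪ S.noRW k)), false)
  | C, l, nl, .lockRel k =>
    -- entries that mention a variable that is no longer stable are dropped
    let R : AsmRec Var := (C.2.1 \ S.noW k, C.2.2 \ S.noRW k)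
    ([((l, .lockRel k), C)], none, nl,
      (RegRec.filter C.1 fun e' => ∀ v ∈ e'.vars, VarStable S R v, R), false)

open Classical in
/-- The compiler: code generation, which is reported as failed if the input requirements are
violated. -/
noncomputable def compileCmd (S : Setup Lock Var Val) (ra : RegAlloc Var Val Reg)
    (C : CompRec Var Val Reg) (l : Option ℕ) (nl : ℕ) (c : Cmd Lock Var Val) :
    List (AnnInstr Lock Var Val Reg) × Option ℕ × ℕ × CompRec Var Val Reg × Bool :=
  let (PCs, l', nl', C', f) := compileCore S ra C l nl c
  (PCs, l', nl', C', f || !decide (CompilerInputReqs S C l nl c))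

end Compiler

end Covern

open Covern

/-! Two runs of the target system under one schedule are compared directly, with no bisimulation
constructed on RISC configurations. Each target thread carries a ghost While command. The invariant
`SystemInv` says that in both runs a thread has the same program counter, mode state and ghost
command, that the remaining code implements this command (`Refines`), and that the compilation
record at the counter is true of the registers and the memory (`RecordHolds`). The shared memories
are those of the ghost source system, and their security is recorded in `SourceInv`.

After unfolding loops and discarding finished parts of sequences, which needs neither mode state nor
memory (`Refines.normalize`), a target step is of one of two kinds. It is bookkeeping, which leaves
memory and modes alone and whose next position does not depend on data (`Stutter`). Or it matches
one source step, with the same effect on memory and modes (`Lockstep`). The only data-dependent jump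
is the conditional one. The record says that its register holds the value of a source condition on
stable variables, and `NoHighBranching` makes that value equal in the two runs. Hence the counters
never diverge. That compiled code satisfies `Refines` is `compileCore_refines`; the freshness of
labels behind it is `compileCore_labels`.

On the source side, `SourceInv.step` is the compositionality argument. The mode state of a thread is
determined by the locks it holds, and no lock has two holders. A thread's bisimulation relates
memories that agree on everything low and readable for that thread, but a variable that another
thread holds exclusively may be low and yet differ between the runs. So the bisimulation is kept on
views: memories that have the true values except on such `foreign` variables, where older values are
retained. By its guarantees a thread does not access foreign variables, so its steps transfer
between memory and view (`DoesntRW.override`). When a lock is released, the views of the other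
threads are refreshed; this is a globally consistent change, because the bisimulation of the
releasing thread gives low-equality at that moment. Foreign variables are closed under control
variables in both directions, so mixing a view with a memory does not disturb classifications. -/

namespace Covern

/-! ### Mixing two memories, classifications, and determinism of schedules -/

section Theory

variable {T X V : Type*}

@[simp]
theorem upd_self (mem : X → V) (x : X) (v : V) : upd mem x v x = v := by simp [upd]

theorem upd_of_ne (mem : X → V) {x y : X} (v : V) (h : y ≠ x) : upd mem x v y = mem y := by
  simp [upd, h]

theorem upd_eq_self (mem : X → V) (x : X) : upd mem x (mem x) = mem := by simp [upd]

/-- The memory that takes its values from `g` on `U` and from `mem` elsewhere. -/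
noncomputable def override (U : Set X) (g mem : X → V) : X → V :=
  open Classical in fun x => if x ∈ U then g x else mem x

theorem override_of_mem {U : Set X} {g mem : X → V} {x : X} (h : x ∈ U) :
    override U g mem x = g x := by simp [override, h]

theorem override_of_notMem {U : Set X} {g mem : X → V} {x : X} (h : x ∉ U) :
    override U g mem x = mem x := by simp [override, h]

theorem override_eq_self {U : Set X} {g mem : X → V} (h : ∀ x ∉ U, g x = mem x) :
    override U g mem = g := by
  funext x
  by_cases hx : x ∈ U
  · rw [override_of_mem hx]
  · rw [override_of_notMem hx, h x hx]

theorem override_empty (g mem : X → V) : override ∅ g mem = mem := by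
  funext x; simp [override]

theorem override_insert (a : X) (U : Set X) (g mem : X → V) :
    override (insert a U) g mem = upd (override U g mem) a (g a) := by
  funext x
  by_cases hx : x = a
  · subst hx; simp [override]
  · rw [upd_of_ne _ _ hx]
    by_cases h : x ∈ U
    · rw [override_of_mem h, override_of_mem (Set.mem_insert_of_mem a h)]
    · rw [override_of_notMem h, override_of_notMem (by simp [hx, h])]

/-- `DoesntRW` permits the replacement of one variable at a time, before and after the step. As
there are finitely many variables, induction replaces all of `U`. This moves steps between the
actual memory and a thread's view of it. -/
theorem DoesntRW.override [Finite X] {dma : (X → V) → X → Sec} {eval : Eval T X V} {c c' : T}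
    {mds mds' : Mds X} {mem mem' : X → V} (U : Set X) (hU : ∀ x ∈ U, DoesntRW dma eval c x)
    (h : eval ⟨c, mds, mem⟩ ⟨c', mds', mem'⟩) (g : X → V) :
    eval ⟨c, mds, override U g mem⟩ ⟨c', mds', override U g mem'⟩ := by
  induction U, U.toFinite using Set.Finite.induction_on with
  | empty => simpa only [override_empty] using h
  | insert _ _ ih =>
    rw [override_insert, override_insert]
    exact hU _ (Set.mem_insert _ _) _ _ _ _ _
      (ih fun x hx => hU x (Set.mem_insert_of_mem _ hx)) _ (Or.inl rfl) _

/-- `Cvars` speaks of single updates only, but finitely many of them lead from one memory to the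
other. An update at a control variable writes the value that is already there; one at any other
variable cannot affect the classification. -/
theorem dma_congr [Finite X] {dma : (X → V) → X → Sec} {x : X} {mem mem' : X → V}
    (h : ∀ y ∈ Cvars dma x, mem y = mem' y) : dma mem x = dma mem' x := by
  have key : ∀ U : Set X, dma (override U mem' mem) x = dma mem x := by
    intro U
    induction U, U.toFinite using Set.Finite.induction_on with
    | empty => rw [override_empty]
    | @insert a U ha _ ih =>
      rw [override_insert, ← ih]
      by_cases hc : a ∈ Cvars dma x
      · rw [← h a hc, ← override_of_notMem (g := mem') (mem := mem) ha, upd_eq_self]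
      · by_contra hne
        exact hc ⟨_, _, hne⟩
  rw [← key Set.univ, override_eq_self (by simp)]

theorem LocReach.trans {dma : (X → V) → X → Sec} {eval : Eval T X V} {a b c : LocalConf T X V}
    (h₁ : LocReach dma eval a b) (h₂ : LocReach dma eval b c) : LocReach dma eval a c := by
  induction h₂ with
  | refl => exact h₁
  | step _ h ih => exact ih.step h
  | memDiff _ h ih => exact ih.memDiff h

theorem LocalModeUse.of_reach {dma : (X → V) → X → Sec} {eval : Eval T X V}
    {a b : LocalConf T X V} (h : LocalModeUse dma eval a) (hab : LocReach dma eval a b) :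
    LocalModeUse dma eval b :=
  fun _ hc => h _ (hab.trans hc)

/-- Resetting a variable to its own old value leaves the initial configuration as it is, so by
determinism the final memory also has that old value there. Applied to `x` and its control
variables, this fixes both value and classification. -/
theorem DoesntRW.doesntW [Finite X] {dma : (X → V) → X → Sec} {eval : Eval T X V}
    (hdet : ∀ lc a b, eval lc a → eval lc b → a = b) {c : T} {x : X}
    (h : DoesntRW dma eval c x) : DoesntW dma eval c x := by
  intro mds mem c' mds' mem' hstep
  have key : ∀ y, y = x ∨ y ∈ Cvars dma x → mem y = mem' y := by
    intro y hy
    have h₁ := h _ _ _ _ _ hstep y hy (mem y)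
    rw [upd_eq_self] at h₁
    have h₂ := congrArg (fun lc => lc.mem y) (hdet _ _ _ hstep h₁)
    simpa using h₂.symm
  exact ⟨key x (Or.inl rfl), dma_congr fun y hy => key y (Or.inr hy)⟩

theorem SchedStep.det {eval : Eval T X V} (hdet : ∀ lc a b, eval lc a → eval lc b → a = b)
    {n : ℕ} {gc a b : GlobalConf T X V} (ha : SchedStep eval n gc a)
    (hb : SchedStep eval n gc b) : a = b := by
  obtain ⟨_, _, _, _, h₁, rfl⟩ := ha
  obtain ⟨_, _, _, _, h₂, rfl⟩ := hb
  have := hdet _ _ _ h₁ h₂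
  simp only [LocalConf.mk.injEq] at this
  obtain ⟨rfl, rfl, rfl⟩ := this
  rfl

theorem EvalSched.det {eval : Eval T X V} (hdet : ∀ lc a b, eval lc a → eval lc b → a = b)
    {s : List ℕ} {gc a b : GlobalConf T X V} (ha : EvalSched eval s gc a)
    (hb : EvalSched eval s gc b) : a = b := by
  induction s generalizing gc with
  | nil => exact ha.symm.trans hb
  | cons n s ih =>
    obtain ⟨a', ha₁, ha₂⟩ := ha
    obtain ⟨b', hb₁, hb₂⟩ := hb
    obtain rfl := ha₁.det hdet hb₁
    exact ih ha₂ hb₂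

end Theory

/-! ### Determinism of both languages -/

section Determinism

variable {Lock Var Val Reg : Type*} {S : Setup Lock Var Val}

theorem not_evalWhile_halt {mds : Mds (Lock ⊕ Var)} {mem : Lock ⊕ Var → Val}
    {lc : LocalConf (Cmd Lock Var Val) (Lock ⊕ Var) Val} :
    ¬ EvalWhile S ⟨.halt, mds, mem⟩ lc := by
  intro h; cases h

theorem EvalWhile.det {lc a b : LocalConf (Cmd Lock Var Val) (Lock ⊕ Var) Val}
    (ha : EvalWhile S lc a) (hb : EvalWhile S lc b) : a = b := by
  induction ha generalizing b with
  | seq c₁ c₁' c₂ mds mds' mem mem' h ih =>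
    cases hb with
    | seqStop => exact absurd h not_evalWhile_halt
    | seq _ _ _ _ _ _ _ h' =>
      have := ih h'
      simp only [LocalConf.mk.injEq] at this
      obtain ⟨rfl, rfl, rfl⟩ := this
      rfl
  | seqStop =>
    cases hb with
    | seqStop => rfl
    | seq _ _ _ _ _ _ _ h' => exact absurd h' not_evalWhile_halt
  | _ => cases hb <;> first | rfl | contradiction

theorem EvalRisc.det {lc a b : LocalConf (RiscState Lock Var Val Reg) (Lock ⊕ Var) Val}
    (ha : EvalRisc S lc a) (hb : EvalRisc S lc b) : a = b := by
  cases ha <;> cases hb <;> simp_all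

end Determinism

/-! ### Mode states determined by the set of held locks -/

section Locks

variable {Lock Var Val : Type*} {S : Setup Lock Var Val}

/-- The mode state of a thread that holds exactly the locks in `H`. -/
def heldMds (S : Setup Lock Var Val) (H : Set Lock) : Mds (Lock ⊕ Var)
  | Mode.guarNoW => Sum.inr '' {v | ∃ k, k ∉ H ∧ v ∈ S.noW k}
  | Mode.asmNoW => Sum.inr '' {v | ∃ k, k ∈ H ∧ v ∈ S.noW k}
  | Mode.guarNoRW => Sum.inr '' {v | ∃ k, k ∉ H ∧ v ∈ S.noRW k}
  | Mode.asmNoRW => Sum.inr '' {v | ∃ k, k ∈ H ∧ v ∈ S.noRW k}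

theorem initMds_eq_heldMds : initMds S = heldMds S ∅ := by
  funext m
  cases m <;> simp [initMds, heldMds, Set.ext_iff]

theorem Setup.WellFormed.noW_unique (hS : S.WellFormed) {v : Var} {k k' : Lock}
    (h : v ∈ S.noW k) (h' : v ∈ S.noW k') : k' = k :=
  hS.managed_once v k k' (Or.inl h) (Or.inl h')

theorem Setup.WellFormed.noRW_unique (hS : S.WellFormed) {v : Var} {k k' : Lock}
    (h : v ∈ S.noRW k) (h' : v ∈ S.noRW k') : k' = k :=
  hS.managed_once v k k' (Or.inr h) (Or.inr h')

/-- Each variable is governed by at most one lock, so the guarantees given up for `k` are not also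
owed on account of another lock. -/
theorem lockAcqUpd_heldMds (hS : S.WellFormed) (H : Set Lock) (k : Lock) :
    lockAcqUpd S (heldMds S H) k = heldMds S (insert k H) := by
  have h₁ := @hS.noW_unique
  have h₂ := @hS.noRW_unique
  funext m
  cases m <;> ext x <;> rcases x with x | x <;>
    simp [lockAcqUpd, heldMds] <;> grind

theorem lockRelUpd_heldMds (hS : S.WellFormed) (H : Set Lock) (k : Lock) :
    lockRelUpd S (heldMds S H) k = heldMds S (H \ {k}) := by
  have h₁ := @hS.noW_unique
  have h₂ := @hS.noRW_unique
  funext m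
  cases m <;> ext x <;> rcases x with x | x <;>
    simp [lockRelUpd, heldMds] <;> grind

/-- A lock that governs nothing would pass the release check vacuously. Since `k` governs some
variable, the assumption on that variable comes from a held lock, which can only be `k`. -/
theorem LockHeldMdsCorrect.mem (hS : S.WellFormed) {H : Set Lock} {k : Lock}
    (h : LockHeldMdsCorrect S (heldMds S H) k) : k ∈ H := by
  obtain ⟨v, hv | hv⟩ := Set.nonempty_iff_ne_empty.2 (hS.not_vacuous k)
  · obtain ⟨w, ⟨k', hk', hw⟩, hwv⟩ := ((h v).1 hv).2
    cases hwv
    rwa [← hS.noW_unique hv hw]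
  · obtain ⟨w, ⟨k', hk', hw⟩, hwv⟩ := ((h v).2 hv).2
    cases hwv
    rwa [← hS.noRW_unique hv hw]

/-- A step changes the set of held locks in accordance with the lock memory. -/
theorem EvalWhile.locks (hS : S.WellFormed)
    {lc lc' : LocalConf (Cmd Lock Var Val) (Lock ⊕ Var) Val} (h : EvalWhile S lc lc')
    {H : Set Lock} (hH : lc.mds = heldMds S H) :
    ∃ H', lc'.mds = heldMds S H' ∧
      (∀ k ∈ H', k ∈ H ∨ ¬ S.evLock (lc.mem (Sum.inl k))) ∧
      (∀ k ∈ H', (k ∈ H → S.evLock (lc.mem (Sum.inl k))) → S.evLock (lc'.mem (Sum.inl k))) ∧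
      ∀ k ∉ H, S.evLock (lc.mem (Sum.inl k)) → S.evLock (lc'.mem (Sum.inl k)) := by
  induction h with
  | seq _ _ _ _ _ _ _ _ ih => exact ih hH
  | assign v e mds mem =>
    have : ∀ k, upd mem (Sum.inr v) (e.ev mem) (Sum.inl k) = mem (Sum.inl k) :=
      fun k => upd_of_ne _ _ (by simp)
    exact ⟨H, hH, fun _ h => Or.inl h, fun k hk h => by simpa [this] using h hk,
      fun k _ h => by simpa [this] using h⟩
  | lockAcq k mds mem hk =>
    refine ⟨insert k H, ?_, ?_, ?_, ?_⟩
    · simp only at hH ⊢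
      rw [hH, lockAcqUpd_heldMds hS]
    · rintro k' (rfl | h)
      · exact Or.inr hk
      · exact Or.inl h
    · intro k' hk' h
      by_cases e : k' = k
      · subst e; simpa using hS.evLock_lockTrue
      · simp only at h ⊢
        rw [upd_of_ne _ _ (by simpa using e)]
        exact h (hk'.resolve_left e)
    · intro k' _ h
      by_cases e : k' = k
      · subst e; simpa using hS.evLock_lockTrue
      · simp only at h ⊢
        rwa [upd_of_ne _ _ (by simpa using e)]
  | lockRel k mds mem hk =>
    simp only at hH
    subst hH
    refine ⟨H \ {k}, lockRelUpd_heldMds hS H k, fun _ h => Or.inl h.1, ?_, ?_⟩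
    · intro k' hk' h
      simp only at h ⊢
      rw [upd_of_ne _ _ (by simpa using hk'.2)]
      exact h hk'.1
    · intro k' hk' h
      simp only at h ⊢
      -- The release check forces `k ∈ H`, so a release never frees a lock of another thread.
      rwa [upd_of_ne _ _ (by rintro ⟨⟩; exact hk' (hk.mem hS))]
  | _ => exact ⟨H, hH, fun _ h => Or.inl h, fun _ hk h => h hk, fun _ _ h => h⟩

end Locks

/-! ### Refinement of While commands by points of a RISC program -/

section Simulation

variable {Lock Var Val Reg : Type*}

theorem Exp.ev_congr {e : Exp Var Val} {mem mem' : Lock ⊕ Var → Val}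
    (h : ∀ v ∈ e.vars, mem (Sum.inr v) = mem' (Sum.inr v)) : e.ev mem = e.ev mem' := by
  induction e with
  | const n => rfl
  | var v => exact h v rfl
  | op o e₁ e₂ ih₁ ih₂ =>
    simp only [Exp.ev]
    rw [ih₁ fun v hv => h v (Or.inl hv), ih₂ fun v hv => h v (Or.inr hv)]

theorem RegRec.filter_eq_some {Φ : RegRec Var Val Reg} {p : Exp Var Val → Prop} {r : Reg}
    {e : Exp Var Val} : RegRec.filter Φ p r = some e ↔ Φ r = some e ∧ p e := by
  simp [RegRec.filter, Option.filter_eq_some_iff]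

theorem RegRec.eq_some_of_meet {Φ Φ' : RegRec Var Val Reg} {r : Reg} {e : Exp Var Val}
    (h : RegRec.meet Φ Φ' r = some e) : Φ r = some e ∧ Φ' r = some e := by
  unfold RegRec.meet at h
  split_ifs at h with h'
  exact ⟨h, h' ▸ h⟩

/-- The record `C` claims no more than the record `C'`. -/
def Weaker (C C' : CompRec Var Val Reg) : Prop :=
  (∀ r e, C.1 r = some e → C'.1 r = some e) ∧ C.2 = C'.2

theorem Weaker.refl (C : CompRec Var Val Reg) : Weaker C C := ⟨fun _ _ h => h, rfl⟩

theorem Weaker.trans {C₁ C₂ C₃ : CompRec Var Val Reg} (h₁ : Weaker C₁ C₂) (h₂ : Weaker C₂ C₃) :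
    Weaker C₁ C₃ :=
  ⟨fun r e h => h₂.1 r e (h₁.1 r e h), h₁.2.trans h₂.2⟩

/-- The record `C` is correct for the given mode state, registers and memory. -/
structure RecordHolds (S : Setup Lock Var Val) (C : CompRec Var Val Reg) (mds : Mds (Lock ⊕ Var))
    (regs : Reg → Val) (mem : Lock ⊕ Var → Val) : Prop where
  stable : RegrecStable S C
  noW : ∀ v, v ∈ C.2.1 ↔ Sum.inr v ∈ mds Mode.asmNoW
  noRW : ∀ v, v ∈ C.2.2 ↔ Sum.inr v ∈ mds Mode.asmNoRW
  val : ∀ r e, C.1 r = some e → regs r = e.ev mem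

variable {S : Setup Lock Var Val}

theorem RecordHolds.weaken {C C' : CompRec Var Val Reg} {mds : Mds (Lock ⊕ Var)}
    {regs : Reg → Val} {mem : Lock ⊕ Var → Val} (h : RecordHolds S C' mds regs mem)
    (hC : Weaker C C') : RecordHolds S C mds regs mem where
  stable r e he v hv := hC.2 ▸ h.stable r e (hC.1 r e he) v hv
  noW := hC.2 ▸ h.noW
  noRW := hC.2 ▸ h.noRW
  val r e he := h.val r e (hC.1 r e he)

theorem RecordHolds.not_writable {C : CompRec Var Val Reg} {mds : Mds (Lock ⊕ Var)}
    {regs : Reg → Val} {mem : Lock ⊕ Var → Val} (h : RecordHolds S C mds regs mem) {v : Var}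
    (hv : VarStable S C.2 v) : ¬ Writable mds (Sum.inr v) := by
  rintro ⟨h₁, h₂⟩
  rcases hv.1 with hv | hv
  · exact h₁ ((h.noW v).1 hv)
  · exact h₂ ((h.noRW v).1 hv)

/-- Recorded expressions mention stable variables only, and others may not write these. Hence a
record survives the steps of the other threads. -/
theorem RecordHolds.mem_congr {C : CompRec Var Val Reg} {mds : Mds (Lock ⊕ Var)}
    {regs : Reg → Val} {mem mem' : Lock ⊕ Var → Val} (h : RecordHolds S C mds regs mem)
    (hmem : ∀ x, ¬ Writable mds x → mem x = mem' x) : RecordHolds S C mds regs mem' where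
  stable := h.stable
  noW := h.noW
  noRW := h.noRW
  val r e he := (h.val r e he).trans <| Exp.ev_congr fun v hv =>
    hmem _ (h.not_writable (h.stable r e he v hv))

/-- A program counter together with the compilation record that holds there. -/
abbrev Point (Var Val Reg : Type*) := ℕ × CompRec Var Val Reg

/-- Target steps that correspond to no source step. -/
inductive Stutter (S : Setup Lock Var Val) (P : List (Instr Lock Var Val Reg)) :
    Point Var Val Reg → Point Var Val Reg → Prop
  | load (pc C l r v) : P[pc]? = some (l, .load r v) → VarStable S C.2 v →
      Stutter S P (pc, C) (pc + 1, (upd C.1 r (some (.var v)), C.2))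
  | moveK (pc C l r n) : P[pc]? = some (l, .moveK r n) →
      Stutter S P (pc, C) (pc + 1, (upd C.1 r (some (.const n)), C.2))
  | op (pc C l o r₁ r₂ e₁ e₂) : P[pc]? = some (l, .op o r₁ r₂) → C.1 r₁ = some e₁ →
      C.1 r₂ = some e₂ → Stutter S P (pc, C) (pc + 1, (upd C.1 r₁ (some (.op o e₁ e₂)), C.2))
  | jmp (pc C l t) : P[pc]? = some (l, .jmp t) → Stutter S P (pc, C) (resolve P t, C)
  | nop (pc C l) : P[pc]? = some (l, .nop) → Stutter S P (pc, C) (pc + 1, C)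

variable {P : List (Instr Lock Var Val Reg)}

theorem RecordHolds.upd {C : CompRec Var Val Reg} {mds : Mds (Lock ⊕ Var)}
    {regs : Reg → Val} {mem : Lock ⊕ Var → Val} (h : RecordHolds S C mds regs mem) {e : Exp Var Val}
    (he : ∀ v ∈ e.vars, VarStable S C.2 v) (r : Reg) :
    RecordHolds S (upd C.1 r (some e), C.2) mds (upd regs r (e.ev mem)) mem where
  stable r' e' he' v hv := by
    by_cases hr : r' = r
    · subst hr
      simp only [upd_self, Option.some.injEq] at he'
      exact he v (he' ▸ hv)
    · simp only [upd_of_ne _ _ hr] at he'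
      exact h.stable r' e' he' v hv
  noW := h.noW
  noRW := h.noRW
  val r' e' he' := by
    by_cases hr : r' = r
    · subst hr
      simp only [upd_self, Option.some.injEq] at he' ⊢
      rw [he']
    · simp only [upd_of_ne _ _ hr] at he' ⊢
      exact h.val r' e' he'

/-- None of these instructions branches on data: `σ'` is fixed before the registers and the memory
are given, so two runs at `σ` both arrive at `σ'`. -/
theorem Stutter.step {σ σ' : Point Var Val Reg} (h : Stutter S P σ σ') {mds : Mds (Lock ⊕ Var)}
    {regs : Reg → Val} {mem : Lock ⊕ Var → Val} (hC : RecordHolds S σ.2 mds regs mem) :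
    ∃ regs', EvalRisc S ⟨((σ.1, P), regs), mds, mem⟩ ⟨((σ'.1, P), regs'), mds, mem⟩ ∧
      RecordHolds S σ'.2 mds regs' mem := by
  cases h with
  | load pc C l r v hP hv =>
    refine ⟨_, .load pc P regs mds mem l r v hP, hC.upd (e := .var v) ?_ r⟩
    rintro _ rfl
    exact hv
  | moveK pc C l r n hP =>
    refine ⟨_, .moveK pc P regs mds mem l r n hP, hC.upd (e := .const n) ?_ r⟩
    rintro _ ⟨⟩
  | op pc C l o r₁ r₂ e₁ e₂ hP h₁ h₂ =>
    refine ⟨_, .op pc P regs mds mem l o r₁ r₂ hP, ?_⟩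
    have := hC.upd (e := .op o e₁ e₂) (fun v hv => hv.elim (hC.stable _ _ h₁ v)
      (hC.stable _ _ h₂ v)) r₁
    simpa only [Exp.ev, hC.val _ _ h₁, hC.val _ _ h₂] using this
  | jmp pc C l t hP => exact ⟨_, .jmp pc P regs mds mem l t hP, hC⟩
  | nop pc C l hP => exact ⟨_, .nop pc P regs mds mem l hP, hC⟩

/-- `Refines S P σ c σ'`: from `σ` the program text `P` executes the command `c`, and when `c` has
terminated, it is at `σ'`. -/
inductive Refines (S : Setup Lock Var Val) (P : List (Instr Lock Var Val Reg)) :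
    Point Var Val Reg → Cmd Lock Var Val → Point Var Val Reg → Prop
  | done (σ) : Refines S P σ .halt σ
  | weaken (pc C C' c σ') : Weaker C' C → Refines S P (pc, C') c σ' → Refines S P (pc, C) c σ'
  | stutter (σ₁ σ₂ c σ') : Stutter S P σ₁ σ₂ → Refines S P σ₂ c σ' → Refines S P σ₁ c σ'
  | post (σ₁ σ₂ c σ') : Refines S P σ₁ c σ₂ → Refines S P σ₂ .halt σ' → Refines S P σ₁ c σ'
  | skip (pc C l) : P[pc]? = some (l, .nop) → Refines S P (pc, C) .skip (pc + 1, C)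
  | seq (σ₁ σ₂ σ₃ c₁ c₂) : Refines S P σ₁ c₁ σ₂ → Refines S P σ₂ c₂ σ₃ →
      Refines S P σ₁ (.seq c₁ c₂) σ₃
  | assign (pc C l v e r) : P[pc]? = some (l, .store v r) → C.1 r = some e →
      Refines S P (pc, C) (.assign v e) (pc + 1, (RegRec.filter C.1 fun e' => v ∉ e'.vars, C.2))
  | lockAcq (pc C l k) : P[pc]? = some (l, .lockAcq k) →
      Refines S P (pc, C) (.lockAcq k) (pc + 1, (C.1, (C.2.1 ∪ S.noW k, C.2.2 ∪ S.noRW k)))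
  | lockRel (pc C l k) : P[pc]? = some (l, .lockRel k) →
      Refines S P (pc, C) (.lockRel k) (pc + 1, (RegRec.filter C.1 fun e' => ∀ v ∈ e'.vars,
        VarStable S (C.2.1 \ S.noW k, C.2.2 \ S.noRW k) v, (C.2.1 \ S.noW k, C.2.2 \ S.noRW k)))
  | ite (pc C l e r t c₁ c₂ σ') : P[pc]? = some (l, .jz t r) → C.1 r = some e →
      Refines S P (pc + 1, C) c₁ σ' → Refines S P (resolve P t, C) c₂ σ' →
      Refines S P (pc, C) (.ite e c₁ c₂) σ'
  | whileDo (pc C pc₁ C₁ l e r t c pc₂ C₂) :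
      Relation.ReflTransGen (Stutter S P) (pc, (fun _ => none, C.2)) (pc₁, C₁) →
      P[pc₁]? = some (l, .jz t r) → C₁.1 r = some e → Refines S P (pc₁ + 1, C₁) c (pc₂, C₂) →
      Stutter S P (pc₂, C₂) (pc, C₂) → C₂.2 = C.2 →
      Refines S P (pc, C) (.whileDo e c) (resolve P t, C₁)

theorem Refines.stutters {σ₁ σ₂ σ' : Point Var Val Reg} {c : Cmd Lock Var Val}
    (h : Relation.ReflTransGen (Stutter S P) σ₁ σ₂) (hc : Refines S P σ₂ c σ') :
    Refines S P σ₁ c σ' := by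
  induction h using Relation.ReflTransGen.head_induction_on with
  | refl => exact hc
  | head h _ ih => exact .stutter _ _ _ _ h ih

/-- The source command can take a step, which the target, at `σ`, can match; two runs of the target
that match source steps to the same command remain at the same point. -/
structure Lockstep (S : Setup Lock Var Val) (P : List (Instr Lock Var Val Reg))
    (σ : Point Var Val Reg) (c : Cmd Lock Var Val) (σE : Point Var Val Reg) : Prop where
  cond_stable : RegrecStable S σ.2 → ∀ e c₁ c₂, c.leftmost = .ite e c₁ c₂ →
    ∀ v ∈ e.vars, VarStable S σ.2.2 v
  progress : ∀ mds mem, ∃ c' mds' mem', EvalWhile S ⟨c, mds, mem⟩ ⟨c', mds', mem'⟩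
  steps : ∀ c' mds mds' mem₁ mem₂ mem₁' mem₂' regs₁ regs₂,
    EvalWhile S ⟨c, mds, mem₁⟩ ⟨c', mds', mem₁'⟩ →
    EvalWhile S ⟨c, mds, mem₂⟩ ⟨c', mds', mem₂'⟩ →
    (∀ e c₁ c₂, c.leftmost = .ite e c₁ c₂ → e.ev mem₁ = e.ev mem₂) →
    RecordHolds S σ.2 mds regs₁ mem₁ → RecordHolds S σ.2 mds regs₂ mem₂ →
    ∃ σ', Refines S P σ' c' σE ∧
      EvalRisc S ⟨((σ.1, P), regs₁), mds, mem₁⟩ ⟨((σ'.1, P), regs₁), mds', mem₁'⟩ ∧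
      EvalRisc S ⟨((σ.1, P), regs₂), mds, mem₂⟩ ⟨((σ'.1, P), regs₂), mds', mem₂'⟩ ∧
      RecordHolds S σ'.2 mds' regs₁ mem₁' ∧ RecordHolds S σ'.2 mds' regs₂ mem₂'

theorem Lockstep.skip {pc : ℕ} {C : CompRec Var Val Reg} {l} (hP : P[pc]? = some (l, .nop)) :
    Lockstep S P (pc, C) .skip (pc + 1, C) where
  cond_stable := by simp [Cmd.leftmost]
  progress mds mem := ⟨_, _, _, .skip mds mem⟩
  steps c' mds mds' mem₁ mem₂ mem₁' mem₂' regs₁ regs₂ h₁ h₂ _ hC₁ hC₂ := by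
    cases h₁
    cases h₂
    exact ⟨_, .done _, .nop _ _ _ _ _ _ hP, .nop _ _ _ _ _ _ hP, hC₁, hC₂⟩

theorem RecordHolds.store {C : CompRec Var Val Reg} {mds : Mds (Lock ⊕ Var)}
    {regs : Reg → Val} {mem : Lock ⊕ Var → Val} (h : RecordHolds S C mds regs mem) (v : Var)
    (n : Val) :
    RecordHolds S (RegRec.filter C.1 fun e' => v ∉ e'.vars, C.2) mds regs
      (Covern.upd mem (Sum.inr v) n) where
  stable r e he := h.stable r e (RegRec.filter_eq_some.1 he).1
  noW := h.noW
  noRW := h.noRW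
  val r e he := by
    obtain ⟨he, hv⟩ := RegRec.filter_eq_some.1 he
    rw [h.val r e he]
    refine Exp.ev_congr fun w hw => (upd_of_ne _ _ ?_).symm
    rintro ⟨⟩
    exact hv hw

theorem Lockstep.assign {pc : ℕ} {C : CompRec Var Val Reg} {l v e r}
    (hP : P[pc]? = some (l, .store v r)) (he : C.1 r = some e) :
    Lockstep S P (pc, C) (.assign v e)
      (pc + 1, (RegRec.filter C.1 fun e' => v ∉ e'.vars, C.2)) where
  cond_stable := by simp [Cmd.leftmost]
  progress mds mem := ⟨_, _, _, .assign v e mds mem⟩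
  steps c' mds mds' mem₁ mem₂ mem₁' mem₂' regs₁ regs₂ h₁ h₂ _ hC₁ hC₂ := by
    cases h₁
    cases h₂
    rw [← hC₁.val r e he, ← hC₂.val r e he]
    exact ⟨_, .done _, .store _ _ _ _ _ _ _ _ hP, .store _ _ _ _ _ _ _ _ hP,
      hC₁.store v _, hC₂.store v _⟩

theorem VarStable.mono {R R' : AsmRec Var} (h₁ : R.1 ⊆ R'.1) (h₂ : R.2 ⊆ R'.2) {v : Var}
    (h : VarStable S R v) : VarStable S R' v :=
  ⟨Set.union_subset_union h₁ h₂ h.1, fun v' hv' => Set.union_subset_union h₁ h₂ (h.2 v' hv')⟩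

theorem Exp.ev_upd_lock (e : Exp Var Val) (mem : Lock ⊕ Var → Val) (k : Lock) (n : Val) :
    e.ev (upd mem (Sum.inl k) n) = e.ev mem :=
  Exp.ev_congr fun _ _ => upd_of_ne _ _ (by simp)

theorem RecordHolds.lockAcq {C : CompRec Var Val Reg} {mds : Mds (Lock ⊕ Var)}
    {regs : Reg → Val} {mem : Lock ⊕ Var → Val} (h : RecordHolds S C mds regs mem) (k : Lock) :
    RecordHolds S (C.1, (C.2.1 ∪ S.noW k, C.2.2 ∪ S.noRW k)) (lockAcqUpd S mds k) regs
      (Covern.upd mem (Sum.inl k) S.lockTrue) where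
  stable r e he v hv := (h.stable r e he v hv).mono Set.subset_union_left Set.subset_union_left
  noW v := by simp [lockAcqUpd, h.noW]
  noRW v := by simp [lockAcqUpd, h.noRW]
  val r e he := by rw [Exp.ev_upd_lock, h.val r e he]

theorem RecordHolds.lockRel {C : CompRec Var Val Reg} {mds : Mds (Lock ⊕ Var)}
    {regs : Reg → Val} {mem : Lock ⊕ Var → Val} (h : RecordHolds S C mds regs mem) (k : Lock) :
    RecordHolds S (RegRec.filter C.1 fun e' => ∀ v ∈ e'.vars,
        VarStable S (C.2.1 \ S.noW k, C.2.2 \ S.noRW k) v, (C.2.1 \ S.noW k, C.2.2 \ S.noRW k))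
      (lockRelUpd S mds k) regs (Covern.upd mem (Sum.inl k) S.lockFalse) where
  stable r e he v hv := (RegRec.filter_eq_some.1 he).2 v hv
  noW v := by simp [lockRelUpd, h.noW]
  noRW v := by simp [lockRelUpd, h.noRW]
  val r e he := by rw [Exp.ev_upd_lock, h.val r e (RegRec.filter_eq_some.1 he).1]

theorem Lockstep.lockAcq {pc : ℕ} {C : CompRec Var Val Reg} {l k}
    (hP : P[pc]? = some (l, .lockAcq k)) :
    Lockstep S P (pc, C) (.lockAcq k)
      (pc + 1, (C.1, (C.2.1 ∪ S.noW k, C.2.2 ∪ S.noRW k))) where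
  cond_stable := by simp [Cmd.leftmost]
  progress mds mem := by
    by_cases h : S.evLock (mem (Sum.inl k))
    · exact ⟨_, _, _, .lockSpin k mds mem h⟩
    · exact ⟨_, _, _, .lockAcq k mds mem h⟩
  steps c' mds mds' mem₁ mem₂ mem₁' mem₂' regs₁ regs₂ h₁ h₂ _ hC₁ hC₂ := by
    cases h₁ with
    | lockAcq _ _ _ h₁ =>
      cases h₂ with
      | lockAcq _ _ _ h₂ =>
        exact ⟨_, .done _, .lockAcq _ _ _ _ _ _ _ hP h₁, .lockAcq _ _ _ _ _ _ _ hP h₂,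
          hC₁.lockAcq k, hC₂.lockAcq k⟩
    | lockSpin _ _ _ h₁ =>
      cases h₂ with
      | lockSpin _ _ _ h₂ =>
        exact ⟨_, .lockAcq _ _ _ _ hP, .lockSpin _ _ _ _ _ _ _ hP h₁,
          .lockSpin _ _ _ _ _ _ _ hP h₂, hC₁, hC₂⟩

theorem Lockstep.lockRel {pc : ℕ} {C : CompRec Var Val Reg} {l k}
    (hP : P[pc]? = some (l, .lockRel k)) :
    Lockstep S P (pc, C) (.lockRel k)
      (pc + 1, (RegRec.filter C.1 fun e' => ∀ v ∈ e'.vars,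
        VarStable S (C.2.1 \ S.noW k, C.2.2 \ S.noRW k) v,
        (C.2.1 \ S.noW k, C.2.2 \ S.noRW k))) where
  cond_stable := by simp [Cmd.leftmost]
  progress mds mem := by
    by_cases h : LockHeldMdsCorrect S mds k
    · exact ⟨_, _, _, .lockRel k mds mem h⟩
    · exact ⟨_, _, _, .lockInvalid k mds mem h⟩
  steps c' mds mds' mem₁ mem₂ mem₁' mem₂' regs₁ regs₂ h₁ h₂ _ hC₁ hC₂ := by
    generalize hmds : mds' = mds₂ at h₂
    cases h₁ with
    | lockRel _ _ _ h₁ =>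
      cases h₂ with
      | lockRel _ _ _ h₂ =>
        exact ⟨_, .done _, .lockRel _ _ _ _ _ _ _ hP h₁, .lockRel _ _ _ _ _ _ _ hP h₂,
          hC₁.lockRel k, hC₂.lockRel k⟩
    | lockInvalid _ _ _ h₁ =>
      cases h₂ with
      | lockInvalid _ _ _ h₂ =>
        exact ⟨_, .lockRel _ _ _ _ hP, .lockInvalid _ _ _ _ _ _ _ hP h₁,
          .lockInvalid _ _ _ _ _ _ _ hP h₂, hC₁, hC₂⟩

/-- The register holds the value of `e` in each run, and these values coincide, so both runs take
the same branch. -/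
theorem Lockstep.ite {pc : ℕ} {C : CompRec Var Val Reg} {l e r t c₁ c₂ σ'}
    (hP : P[pc]? = some (l, .jz t r)) (he : C.1 r = some e)
    (hc₁ : Refines S P (pc + 1, C) c₁ σ') (hc₂ : Refines S P (resolve P t, C) c₂ σ') :
    Lockstep S P (pc, C) (.ite e c₁ c₂) σ' where
  cond_stable := by
    rintro hC _ _ _ ⟨⟩
    exact hC r e he
  progress mds mem := by
    by_cases h : e.ev mem = S.zero
    · exact ⟨_, _, _, .iteFalse e c₁ c₂ mds mem h⟩
    · exact ⟨_, _, _, .iteTrue e c₁ c₂ mds mem h⟩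
  steps c' mds mds' mem₁ mem₂ mem₁' mem₂' regs₁ regs₂ h₁ h₂ hcond hC₁ hC₂ := by
    have hev := hcond e c₁ c₂ rfl
    by_cases h : e.ev mem₁ = S.zero
    · obtain ⟨⟩ := h₁.det (.iteFalse e c₁ c₂ mds mem₁ h)
      obtain ⟨⟩ := h₂.det (.iteFalse e _ _ mds mem₂ (hev ▸ h))
      exact ⟨_, hc₂, .jzTaken _ _ _ _ _ _ _ _ hP ((hC₁.val r e he).trans h),
        .jzTaken _ _ _ _ _ _ _ _ hP ((hC₂.val r e he).trans (hev ▸ h)), hC₁, hC₂⟩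
    · obtain ⟨⟩ := h₁.det (.iteTrue e c₁ c₂ mds mem₁ h)
      obtain ⟨⟩ := h₂.det (.iteTrue e _ _ mds mem₂ (hev ▸ h))
      exact ⟨_, hc₁, .jzNotTaken _ _ _ _ _ _ _ _ hP ((hC₁.val r e he).trans_ne h),
        .jzNotTaken _ _ _ _ _ _ _ _ hP ((hC₂.val r e he).trans_ne (hev ▸ h)), hC₁, hC₂⟩

theorem Lockstep.post {σ σ₁ σ₂ : Point Var Val Reg} {c : Cmd Lock Var Val}
    (h : Lockstep S P σ c σ₁) (h' : Refines S P σ₁ .halt σ₂) : Lockstep S P σ c σ₂ where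
  cond_stable := h.cond_stable
  progress := h.progress
  steps c' mds mds' mem₁ mem₂ mem₁' mem₂' regs₁ regs₂ h₁ h₂ hcond hC₁ hC₂ := by
    obtain ⟨σ', hσ', hrest⟩ := h.steps _ _ _ _ _ _ _ _ _ h₁ h₂ hcond hC₁ hC₂
    exact ⟨σ', .post _ _ _ _ hσ' h', hrest⟩

theorem Lockstep.seq {σ σ₁ σ₂ : Point Var Val Reg} {c₁ c₂ : Cmd Lock Var Val}
    (h : Lockstep S P σ c₁ σ₁) (h' : Refines S P σ₁ c₂ σ₂) :
    Lockstep S P σ (.seq c₁ c₂) σ₂ where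
  cond_stable := h.cond_stable
  progress mds mem := by
    obtain ⟨_, _, _, hstep⟩ := h.progress mds mem
    exact ⟨_, _, _, .seq _ _ c₂ _ _ _ _ hstep⟩
  steps c' mds mds' mem₁ mem₂ mem₁' mem₂' regs₁ regs₂ h₁ h₂ hcond hC₁ hC₂ := by
    -- Discarding a finished first part is left to the silent steps; here it is excluded because
    -- `c₁` can progress.
    have hne : c₁ ≠ .halt := by
      rintro rfl
      obtain ⟨_, _, _, hstep⟩ := h.progress mds mem₁
      exact not_evalWhile_halt hstep
    cases h₁ with
    | seqStop => exact absurd rfl hne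
    | seq _ _ _ _ _ _ _ h₁ =>
      cases h₂ with
      | seq _ _ _ _ _ _ _ h₂ =>
        obtain ⟨σ', hσ', hrest⟩ := h.steps _ _ _ _ _ _ _ _ _ h₁ h₂ hcond hC₁ hC₂
        exact ⟨σ', .seq _ _ _ _ _ hσ' h', hrest⟩

/-- Source steps that neither depend on nor change the mode state and the memory. -/
def Silent (S : Setup Lock Var Val) (c c' : Cmd Lock Var Val) : Prop :=
  ∀ mds mem, EvalWhile S ⟨c, mds, mem⟩ ⟨c', mds, mem⟩

theorem Silent.seq {c c' : Cmd Lock Var Val} (h : Relation.ReflTransGen (Silent S) c c')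
    (c₂ : Cmd Lock Var Val) :
    Relation.ReflTransGen (Silent S) (.seq c c₂) (.seq c' c₂) := by
  induction h with
  | refl => exact .refl
  | tail _ h ih => exact ih.tail fun mds mem => .seq _ _ _ _ _ _ _ (h mds mem)

/-- What the target does next. -/
inductive Ready (S : Setup Lock Var Val) (P : List (Instr Lock Var Val Reg))
    (σ : Point Var Val Reg) (c : Cmd Lock Var Val) (σE : Point Var Val Reg) : Prop
  | done : c = .halt → σ.1 = σE.1 → Weaker σE.2 σ.2 → Ready S P σ c σE
  | stutter (C : CompRec Var Val Reg) (σ' : Point Var Val Reg) : Weaker C σ.2 →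
      Stutter S P (σ.1, C) σ' → Refines S P σ' c σE → Ready S P σ c σE
  | lockstep (C : CompRec Var Val Reg) : Weaker C σ.2 → Lockstep S P (σ.1, C) c σE →
      Ready S P σ c σE

theorem Ready.weaken {pc : ℕ} {C C' : CompRec Var Val Reg} {σ' : Point Var Val Reg}
    {c : Cmd Lock Var Val} (h : Ready S P (pc, C') c σ') (hC : Weaker C' C) :
    Ready S P (pc, C) c σ' := by
  cases h with
  | done h₁ h₂ h₃ => exact .done h₁ h₂ (h₃.trans hC)
  | stutter C₁ σ₁ h₁ h₂ h₃ => exact .stutter C₁ σ₁ (h₁.trans hC) h₂ h₃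
  | lockstep C₁ h₁ h₂ => exact .lockstep C₁ (h₁.trans hC) h₂

/-- Silent source steps lead to a command with which the target can proceed. -/
theorem Refines.normalize {σ σ' : Point Var Val Reg} {c : Cmd Lock Var Val}
    (h : Refines S P σ c σ') :
    ∃ c', Relation.ReflTransGen (Silent S) c c' ∧ Ready S P σ c' σ' := by
  induction h with
  | done σ => exact ⟨_, .refl, .done rfl rfl (Weaker.refl _)⟩
  | weaken pc C C' c σ' hC _ ih =>
    obtain ⟨c', hc, h⟩ := ih
    exact ⟨c', hc, h.weaken hC⟩
  | stutter σ₁ σ₂ c σ' h₁ h₂ => exact ⟨_, .refl, .stutter _ _ (Weaker.refl _) h₁ h₂⟩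
  | post σ₁ σ₂ c σ' _ h₂ ih₁ ih₂ =>
    obtain ⟨c', hc, h⟩ := ih₁
    refine ⟨c', hc, ?_⟩
    cases h with
    | done hc' hpc hC =>
      subst hc'
      obtain ⟨c'', hc'', h⟩ := ih₂
      obtain rfl : c'' = .halt := by
        rcases hc''.cases_head with h | ⟨_, h, _⟩
        · exact h.symm
        -- Any mode state and memory would serve: a silent step exists for all of them, and `halt`
        -- has none.
        · exact absurd (h (initMds S) fun _ => S.zero) not_evalWhile_halt
      obtain ⟨pc, C⟩ := σ₁
      obtain ⟨pc₂, C₂⟩ := σ₂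
      obtain rfl : pc = pc₂ := hpc
      exact h.weaken hC
    | stutter C σ₃ hC hs hr => exact .stutter C σ₃ hC hs (.post _ _ _ _ hr h₂)
    | lockstep C hC hl => exact .lockstep C hC (hl.post h₂)
  | skip pc C l hP => exact ⟨_, .refl, .lockstep _ (Weaker.refl _) (.skip hP)⟩
  | seq σ₁ σ₂ σ₃ c₁ c₂ _ h₂ ih₁ ih₂ =>
    obtain ⟨c', hc, h⟩ := ih₁
    cases h with
    | done hc' hpc hC =>
      subst hc'
      obtain ⟨c'', hc'', h⟩ := ih₂
      obtain ⟨pc, C⟩ := σ₁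
      obtain ⟨pc₂, C₂⟩ := σ₂
      obtain rfl : pc = pc₂ := hpc
      exact ⟨c'', (Silent.seq hc c₂).trans (.head (fun mds mem => .seqStop _ _ _) hc''),
        h.weaken hC⟩
    | stutter C σ₃ hC hs hr =>
      exact ⟨_, Silent.seq hc c₂, .stutter C σ₃ hC hs (.seq _ _ _ _ _ hr h₂)⟩
    | lockstep C hC hl => exact ⟨_, Silent.seq hc c₂, .lockstep C hC (hl.seq h₂)⟩
  | assign pc C l v e r hP he =>
    exact ⟨_, .refl, .lockstep _ (Weaker.refl _) (.assign hP he)⟩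
  | lockAcq pc C l k hP => exact ⟨_, .refl, .lockstep _ (Weaker.refl _) (.lockAcq hP)⟩
  | lockRel pc C l k hP => exact ⟨_, .refl, .lockstep _ (Weaker.refl _) (.lockRel hP)⟩
  | ite pc C l e r t c₁ c₂ σ' hP he h₁ h₂ =>
    exact ⟨_, .refl, .lockstep _ (Weaker.refl _) (.ite hP he h₁ h₂)⟩
  | whileDo pc C pc₁ C₁ l e r t c pc₂ C₂ hs hP he hc hj hC =>
    -- The loop head is analysed with an empty register record, which is weaker than any record with
    -- which control arrives there.
    have hw : ∀ C' : CompRec Var Val Reg, C'.2 = C.2 → Weaker (fun _ => none, C.2) C' :=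
      fun C' h => ⟨by simp, h.symm⟩
    -- After the body, the backward jump returns to the head with record `C₂`. As the body restores
    -- the assumptions, the same data refine the loop again, now from `C₂`; no infinite unfolding is
    -- needed.
    have hloop : Refines S P (pc₂, C₂) (.whileDo e c) (resolve P t, C₁) := by
      refine .stutter _ _ _ _ hj (.whileDo pc C₂ pc₁ C₁ l e r t c pc₂ C₂ ?_ hP he hc hj rfl)
      rwa [hC]
    have hbody := Refines.seq _ _ _ _ _ hc hloop
    refine ⟨.ite e (.seq c (.whileDo e c)) .halt, .single fun mds mem => .whileDo _ _ _ _, ?_⟩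
    rcases hs.cases_head with h | ⟨σ₁, h₁, h₂⟩
    · obtain ⟨rfl, rfl⟩ := Prod.mk.inj h
      exact .lockstep _ (hw C rfl) (.ite hP he hbody (.done _))
    · exact .stutter _ σ₁ (hw C rfl) h₁ (Refines.stutters h₂ (.ite _ _ _ _ _ _ _ _ _ hP he hbody (.done _)))

end Simulation

/-! ### Compiled code refines its source -/

section CompilerCorrectness

variable {Lock Var Val Reg : Type*} {S : Setup Lock Var Val} {ra : RegAlloc Var Val Reg}

/-- The labels that occur in an annotated program, in order. -/
def annLabels (Q : List (AnnInstr Lock Var Val Reg)) : List ℕ := Q.filterMap fun a => a.1.1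

@[simp]
theorem annLabels_nil : annLabels ([] : List (AnnInstr Lock Var Val Reg)) = [] := rfl

@[simp]
theorem annLabels_append (Q Q' : List (AnnInstr Lock Var Val Reg)) :
    annLabels (Q ++ Q') = annLabels Q ++ annLabels Q' := List.filterMap_append

@[simp]
theorem annLabels_cons (a : AnnInstr Lock Var Val Reg) (Q : List (AnnInstr Lock Var Val Reg)) :
    annLabels (a :: Q) = a.1.1.toList ++ annLabels Q := by
  rcases h : a.1.1 with _ | t <;> simp [annLabels, h]

/-- `resolve` finds the first occurrence of a label, which is the only one when no label is
repeated. -/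
theorem resolve_eq_of_getElem? {P : List (Instr Lock Var Val Reg)} {pos t : ℕ}
    {b : RiscOp Lock Var Val Reg} (hP : (P.filterMap Prod.fst).Nodup)
    (h : P[pos]? = some (some t, b)) : resolve P t = pos := by
  induction P generalizing pos with
  | nil => simp at h
  | cons i P ih =>
    obtain ⟨l, i⟩ := i
    cases pos with
    | zero =>
      simp only [List.getElem?_cons_zero, Option.some.injEq, Prod.mk.injEq] at h
      simp [resolve, List.findIdx_cons, h.1]
    | succ pos =>
      rw [List.getElem?_cons_succ] at h
      have hmem : t ∈ P.filterMap Prod.fst :=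
        List.mem_filterMap.2 ⟨_, List.mem_of_getElem? h, rfl⟩
      have hne : l ≠ some t := by
        rintro rfl
        simp only [List.filterMap_cons, List.nodup_cons] at hP
        exact hP.1 hmem
      have hP' : (P.filterMap Prod.fst).Nodup := by
        cases l with
        | none => simpa using hP
        | some x => simp only [List.filterMap_cons, List.nodup_cons] at hP; exact hP.2
      have := ih hP' h
      simp only [resolve] at this ⊢
      simp [List.findIdx_cons, beq_false_of_ne hne, this]

theorem resolve_eq_length {P : List (Instr Lock Var Val Reg)} {t : ℕ}
    (h : t ∉ P.filterMap Prod.fst) : resolve P t = P.length := by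
  refine List.findIdx_eq_length.2 fun i hi => ?_
  simp only [List.mem_filterMap, not_exists, not_and] at h
  simpa using h i hi

/-- The instructions of `Q` stand in `P` from position `pc` on. -/
def CodeAt (P : List (Instr Lock Var Val Reg)) : ℕ → List (AnnInstr Lock Var Val Reg) → Prop
  | _, [] => True
  | pc, a :: Q => P[pc]? = some a.1 ∧ CodeAt P (pc + 1) Q

theorem codeAt_append {P : List (Instr Lock Var Val Reg)} {pc : ℕ}
    {Q Q' : List (AnnInstr Lock Var Val Reg)} :
    CodeAt P pc (Q ++ Q') ↔ CodeAt P pc Q ∧ CodeAt P (pc + Q.length) Q' := by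
  induction Q generalizing pc with
  | nil => simp [CodeAt]
  | cons a Q ih =>
    simp only [List.cons_append, CodeAt, ih, List.length_cons, and_assoc]
    rw [Nat.add_right_comm, Nat.add_assoc]

theorem codeAt_self (Q : List (AnnInstr Lock Var Val Reg)) : CodeAt (Q.map Prod.fst) 0 Q := by
  have key : ∀ (Q : List (AnnInstr Lock Var Val Reg)) (P : List (Instr Lock Var Val Reg)),
      CodeAt (P ++ Q.map Prod.fst) P.length Q := by
    intro Q
    induction Q with
    | nil => intro P; trivial
    | cons a Q ih =>
      intro P
      refine ⟨by simp, ?_⟩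
      simpa using ih (P ++ [a.1])
  simpa using key Q []

/-- The first instruction has the label `l` and the others have none. -/
def HeadLabelled (l : Option ℕ) : List (AnnInstr Lock Var Val Reg) → Prop
  | [] => True
  | a :: Q => a.1.1 = l ∧ annLabels Q = []

/-- The code of an expression is empty when it is a cached variable; the label must then pass on to
the instruction that follows. -/
theorem HeadLabelled.append {l : Option ℕ} {Q Q' : List (AnnInstr Lock Var Val Reg)}
    (h : HeadLabelled l Q) (h' : HeadLabelled (if Q.isEmpty then l else none) Q') :
    HeadLabelled l (Q ++ Q') := by
  cases Q with
  | nil => simpa using h'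
  | cons a Q =>
    refine ⟨h.1, ?_⟩
    change annLabels (Q ++ Q') = []
    rw [annLabels_append, h.2]
    cases Q' with
    | nil => rfl
    | cons a' Q' =>
      obtain ⟨h₁, h₂⟩ := h'
      simp [h₂, h₁]

theorem HeadLabelled.snoc {l : Option ℕ} {Q : List (AnnInstr Lock Var Val Reg)}
    (h : HeadLabelled l Q) (b : RiscOp Lock Var Val Reg) (C : CompRec Var Val Reg) :
    HeadLabelled l (Q ++ [((if Q.isEmpty then l else none, b), C)]) :=
  h.append ⟨rfl, rfl⟩

theorem HeadLabelled.annLabels_snoc {l : Option ℕ} {Q : List (AnnInstr Lock Var Val Reg)}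
    (h : HeadLabelled l Q) (b : RiscOp Lock Var Val Reg) (C : CompRec Var Val Reg) :
    annLabels (Q ++ [((if Q.isEmpty then l else none, b), C)]) = l.toList := by
  cases Q with
  | nil => simp
  | cons a Q => simp [h.1, h.2]

theorem HeadLabelled.head_snoc {l : Option ℕ} {Q : List (AnnInstr Lock Var Val Reg)}
    (h : HeadLabelled l Q) (b : RiscOp Lock Var Val Reg) (C : CompRec Var Val Reg) :
    ∃ a Q', Q ++ [((if Q.isEmpty then l else none, b), C)] = a :: Q' ∧ a.1.1 = l := by
  cases Q with
  | nil => exact ⟨_, _, rfl, rfl⟩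
  | cons a Q => exact ⟨_, _, rfl, h.1⟩

theorem compileExpr_const {C A l n Q r C'}
    (h : compileExpr (Lock := Lock) ra C A l (.const n) = some (Q, r, C')) :
    ra.alloc C.1 A = some r ∧ Q = [((l, .moveK r n), C)] ∧
      C' = (upd C.1 r (some (.const n)), C.2) := by
  simp only [compileExpr] at h
  split at h
  · cases h
  · cases h; exact ⟨by assumption, rfl, rfl⟩

theorem compileExpr_var {C A l v Q r C'}
    (h : compileExpr (Lock := Lock) ra C A l (.var v) = some (Q, r, C')) :
    (ra.cached C.1 A v = some r ∧ Q = [] ∧ C' = C) ∨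
      (ra.alloc C.1 A = some r ∧ Q = [((l, .load r v), C)] ∧
        C' = (upd C.1 r (some (.var v)), C.2)) := by
  simp only [compileExpr] at h
  split at h
  · cases h; exact .inl ⟨by assumption, rfl, rfl⟩
  · split at h
    · cases h
    · cases h; exact .inr ⟨by assumption, rfl, rfl⟩

theorem compileExpr_op {C A l o e₁ e₂ Q r C'}
    (h : compileExpr (Lock := Lock) ra C A l (.op o e₁ e₂) = some (Q, r, C')) :
    ∃ Q₁ C₁ Q₂ r₂ C₂, compileExpr ra C A l e₁ = some (Q₁, r, C₁) ∧
      compileExpr ra C₁ (A ∪ {r}) (if Q₁.isEmpty then l else none) e₂ = some (Q₂, r₂, C₂) ∧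
      Q = Q₁ ++ Q₂ ++ [((if (Q₁ ++ Q₂).isEmpty then l else none, .op o r r₂), C₂)] ∧
      C' = (upd C₂.1 r (some (.op o e₁ e₂)), C₂.2) := by
  simp only [compileExpr] at h
  split at h
  · cases h
  · rename_i h₁
    split at h
    · cases h
    · rename_i h₂
      cases h
      exact ⟨_, _, _, _, _, h₁, h₂, rfl, rfl⟩

theorem compileExpr_headLabelled {e : Exp Var Val} {C A l r C'}
    {Q : List (AnnInstr Lock Var Val Reg)} (h : compileExpr ra C A l e = some (Q, r, C')) :
    HeadLabelled l Q := by
  induction e generalizing C A l Q r C' with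
  | const n =>
    obtain ⟨_, rfl, _⟩ := compileExpr_const h
    exact ⟨rfl, rfl⟩
  | var v =>
    obtain ⟨_, rfl, _⟩ | ⟨_, rfl, _⟩ := compileExpr_var h
    · trivial
    · exact ⟨rfl, rfl⟩
  | op o e₁ e₂ ih₁ ih₂ =>
    obtain ⟨Q₁, C₁, Q₂, r₂, C₂, h₁, h₂, rfl, _⟩ := compileExpr_op h
    exact ((ih₁ h₁).append (ih₂ h₂)).snoc _ _

/-- The clause on `A` is what the operator case uses: the result of the first operand must still be
recorded after the code for the second. -/
theorem compileExpr_record {e : Exp Var Val} {C A l r C'}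
    {Q : List (AnnInstr Lock Var Val Reg)} (h : compileExpr ra C A l e = some (Q, r, C')) :
    C'.2 = C.2 ∧ r ∉ A ∧ C'.1 r = some e ∧ ∀ r' ∈ A, C'.1 r' = C.1 r' := by
  have key : ∀ (Φ : RegRec Var Val Reg) (r : Reg) (x : Option (Exp Var Val)), r ∉ A →
      ∀ r' ∈ A, upd Φ r x r' = Φ r' := by
    intro Φ r x hr r' hr'
    exact upd_of_ne _ _ (by rintro rfl; exact hr hr')
  induction e generalizing C A l Q r C' with
  | const n =>
    obtain ⟨hr, _, rfl⟩ := compileExpr_const h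
    have hr := ra.alloc_notMem _ _ _ hr
    exact ⟨rfl, hr, upd_self _ _ _, key _ _ _ hr⟩
  | var v =>
    obtain ⟨hr, _, rfl⟩ | ⟨hr, _, rfl⟩ := compileExpr_var h
    · exact ⟨rfl, ra.cached_notMem _ _ _ _ hr, ra.cached_eq _ _ _ _ hr, fun _ _ => rfl⟩
    · have hr := ra.alloc_notMem _ _ _ hr
      exact ⟨rfl, hr, upd_self _ _ _, key _ _ _ hr⟩
  | op o e₁ e₂ ih₁ ih₂ =>
    obtain ⟨Q₁, C₁, Q₂, r₂, C₂, h₁, h₂, _, rfl⟩ := compileExpr_op h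
    obtain ⟨a₁, b₁, c₁, d₁⟩ := ih₁ h₁ key
    -- `key` concerns `A`, while the second operand is compiled with `A ∪ {r}`, so it is proved
    -- again for that set.
    obtain ⟨a₂, b₂, c₂, d₂⟩ := ih₂ h₂ fun Φ r x hr r' hr' =>
      upd_of_ne _ _ (by rintro rfl; exact hr hr')
    refine ⟨a₂.trans a₁, b₁, upd_self _ _ _, fun r' hr' => ?_⟩
    change upd C₂.1 r _ r' = _
    rw [key _ _ _ b₁ _ hr', d₂ _ (Or.inl hr'), d₁ _ hr']

theorem compileExpr_stutters {P : List (Instr Lock Var Val Reg)} {e : Exp Var Val} {C A l r C'}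
    {Q : List (AnnInstr Lock Var Val Reg)} (h : compileExpr ra C A l e = some (Q, r, C'))
    (he : ∀ v ∈ e.vars, VarStable S C.2 v) {pc : ℕ} (hQ : CodeAt P pc Q) :
    Relation.ReflTransGen (Stutter S P) (pc, C) (pc + Q.length, C') := by
  induction e generalizing C A l Q r C' pc with
  | const n =>
    obtain ⟨_, rfl, rfl⟩ := compileExpr_const h
    exact .single (.moveK _ _ _ _ _ hQ.1)
  | var v =>
    obtain ⟨_, rfl, rfl⟩ | ⟨_, rfl, rfl⟩ := compileExpr_var h
    · exact .refl
    · exact .single (.load _ _ _ _ _ hQ.1 (he v rfl))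
  | op o e₁ e₂ ih₁ ih₂ =>
    obtain ⟨Q₁, C₁, Q₂, r₂, C₂, h₁, h₂, rfl, rfl⟩ := compileExpr_op h
    obtain ⟨a₁, b₁, c₁, d₁⟩ := compileExpr_record h₁
    obtain ⟨a₂, b₂, c₂, d₂⟩ := compileExpr_record h₂
    simp only [codeAt_append, CodeAt] at hQ
    obtain ⟨⟨hQ₁, hQ₂⟩, hop, -⟩ := hQ
    have s₁ := ih₁ h₁ (fun v hv => he v (Or.inl hv)) hQ₁
    have s₂ := ih₂ h₂ (fun v hv => a₁ ▸ he v (Or.inr hv)) hQ₂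
    refine (s₁.trans s₂).tail ?_
    simp only [List.length_append, List.length_cons, List.length_nil, ← Nat.add_assoc] at hop ⊢
    -- The first result was reserved while the second operand was compiled, so its entry is intact.
    exact .op _ _ _ _ _ _ _ _ hop ((d₂ r (Or.inr rfl)).trans c₁) c₂

theorem compileCore_seq {C l nl c₁ c₂ Q l' nl' C'}
    (h : compileCore S ra C l nl (.seq c₁ c₂) = (Q, l', nl', C', false)) :
    ∃ Q₁ l₁ nl₁ C₁ Q₂, compileCore S ra C l nl c₁ = (Q₁, l₁, nl₁, C₁, false) ∧
      compileCore S ra C₁ l₁ nl₁ c₂ = (Q₂, l', nl', C', false) ∧ Q = Q₁ ++ Q₂ := by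
  rcases h₁ : compileCore S ra C l nl c₁ with ⟨Q₁, l₁, nl₁, C₁, f₁⟩
  rcases h₂ : compileCore S ra C₁ l₁ nl₁ c₂ with ⟨Q₂, l₂, nl₂, C₂, f₂⟩
  simp only [compileCore, h₁, h₂, Prod.mk.injEq, Bool.or_eq_false_iff] at h
  obtain ⟨rfl, rfl, rfl, rfl, rfl, rfl⟩ := h
  exact ⟨_, _, _, _, _, rfl, h₂, rfl⟩

theorem compileCore_ite {C l nl e c₁ c₂ Q l' nl' C'}
    (h : compileCore S ra C l nl (.ite e c₁ c₂) = (Q, l', nl', C', false)) :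
    ∃ Qe r C₁ Q₁ l₁ nl₁ C₂ Q₂ l₂ C₃, compileExpr ra C ∅ l e = some (Qe, r, C₁) ∧
      compileCore S ra C₁ none (nl + 2) c₁ = (Q₁, l₁, nl₁, C₂, false) ∧
      compileCore S ra C₁ (some nl) nl₁ c₂ = (Q₂, l₂, nl', C₃, false) ∧
      Q = Qe ++ [((if Qe.isEmpty then l else none, .jz nl r), C₁)] ++ Q₁ ++
          [((l₁, .jmp (nl + 1)), C₂)] ++ Q₂ ++ [((l₂, .nop), C₃)] ∧
      l' = some (nl + 1) ∧ C' = (RegRec.meet C₂.1 C₃.1, C₂.2) := by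
  rcases he : compileExpr (Lock := Lock) ra C ∅ l e with _ | ⟨Qe, r, C₁⟩
  · simp [compileCore, he] at h
  rcases h₁ : compileCore S ra C₁ none (nl + 2) c₁ with ⟨Q₁, l₁, nl₁, C₂, f₁⟩
  rcases h₂ : compileCore S ra C₁ (some nl) nl₁ c₂ with ⟨Q₂, l₂, nl₂, C₃, f₂⟩
  simp only [compileCore, he, h₁, h₂, Prod.mk.injEq, Bool.or_eq_false_iff] at h
  obtain ⟨rfl, rfl, rfl, rfl, rfl, rfl⟩ := h
  exact ⟨_, _, _, _, _, _, _, _, _, _, rfl, h₁, h₂, rfl, rfl, rfl⟩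

theorem compileCore_whileDo {C l nl e c Q l' nl' C'}
    (h : compileCore S ra C l nl (.whileDo e c) = (Q, l', nl', C', false)) :
    ∃ lp ex Qe r Q₁ l₁ C₂, lp = l.getD nl ∧ ex = (if l.isSome then nl else nl + 1) ∧
      compileExpr ra (fun _ => none, C.2) ∅ (some lp) e = some (Qe, r, C') ∧
      compileCore S ra C' none (ex + 1) c = (Q₁, l₁, nl', C₂, false) ∧
      Q = Qe ++ [((if Qe.isEmpty then some lp else none, .jz ex r), C')] ++ Q₁ ++
          [((l₁, .jmp lp), C₂)] ∧ l' = some ex := by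
  refine ⟨l.getD nl, if l.isSome then nl else nl + 1, ?_⟩
  rcases he : compileExpr (Lock := Lock) ra (fun _ => none, C.2) ∅ (some (l.getD nl)) e with
    _ | ⟨Qe, r, C₁⟩
  · simp [compileCore, he] at h
  rcases h₁ : compileCore S ra C₁ none ((if l.isSome then nl else nl + 1) + 1) c with
    ⟨Q₁, l₁, nl₁, C₂, f₁⟩
  simp only [compileCore, he, h₁, Prod.mk.injEq] at h
  obtain ⟨rfl, rfl, rfl, rfl, rfl⟩ := h
  exact ⟨_, _, _, _, _, rfl, rfl, rfl, h₁, rfl, rfl⟩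

theorem compileCore_assign {C l nl v e Q l' nl' C'}
    (h : compileCore S ra C l nl (.assign v e) = (Q, l', nl', C', false)) :
    ∃ Qe r C₁, compileExpr ra C ∅ l e = some (Qe, r, C₁) ∧
      Q = Qe ++ [((if Qe.isEmpty then l else none, .store v r), C₁)] ∧
      l' = none ∧ nl' = nl ∧ C' = (RegRec.filter C₁.1 fun e' => v ∉ e'.vars, C₁.2) := by
  rcases he : compileExpr (Lock := Lock) ra C ∅ l e with _ | ⟨Qe, r, C₁⟩
  · simp [compileCore, he] at h
  simp only [compileCore, he, Prod.mk.injEq] at h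
  obtain ⟨rfl, rfl, rfl, rfl, _⟩ := h
  exact ⟨_, _, _, rfl, rfl, rfl, rfl, rfl⟩

/-- Successful compilation emits at least one instruction, and a requested label goes on the first.
A jump to this label therefore lands where the code of the command starts. -/
theorem compileCore_head {c : Cmd Lock Var Val} {C l nl Q l' nl' C'}
    (h : compileCore S ra C l nl c = (Q, l', nl', C', false)) {t : ℕ} (hl : l = some t) :
    ∃ a Q', Q = a :: Q' ∧ a.1.1 = some t := by
  induction c generalizing C l nl Q l' nl' C' with
  | halt => simp [compileCore] at h
  | seq c₁ c₂ ih₁ _ =>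
    obtain ⟨Q₁, l₁, nl₁, C₁, Q₂, h₁, h₂, rfl⟩ := compileCore_seq h
    obtain ⟨a, Q', rfl, ha⟩ := ih₁ h₁ hl
    exact ⟨a, _, rfl, ha⟩
  | ite e c₁ c₂ =>
    obtain ⟨Qe, r, C₁, Q₁, l₁, nl₁, C₂, Q₂, l₂, C₃, he, -, -, rfl, -, -⟩ := compileCore_ite h
    obtain ⟨a, Q', hQ, ha⟩ := (compileExpr_headLabelled he).head_snoc (.jz nl r) C₁
    rw [hQ]
    exact ⟨a, _, rfl, ha.trans hl⟩
  | whileDo e c =>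
    obtain ⟨lp, ex, Qe, r, Q₁, l₁, C₂, rfl, -, he, -, rfl, -⟩ := compileCore_whileDo h
    obtain ⟨a, Q', hQ, ha⟩ := (compileExpr_headLabelled he).head_snoc (.jz ex r) C'
    rw [hQ]
    exact ⟨a, _, rfl, by rw [ha, hl]; rfl⟩
  | assign v e =>
    obtain ⟨Qe, r, C₁, he, rfl, -, -, -⟩ := compileCore_assign h
    obtain ⟨a, Q', hQ, ha⟩ := (compileExpr_headLabelled he).head_snoc (.store v r) C₁
    rw [hQ]
    exact ⟨a, _, rfl, ha.trans hl⟩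
  | _ =>
    simp only [compileCore, Prod.mk.injEq] at h
    exact ⟨_, _, h.1.symm, hl⟩

/-- Code generation puts each label in one place, and uses up the labels from `nl` to `nl'`. -/
structure LabelsOK (l : Option ℕ) (nl : ℕ) (L : List ℕ) (l' : Option ℕ) (nl' : ℕ) : Prop where
  le : nl ≤ nl'
  nodup : L.Nodup
  range : ∀ t ∈ L, l = some t ∨ (nl ≤ t ∧ t < nl')
  next : ∀ t, l' = some t → nl ≤ t ∧ t < nl' ∧ t ∉ L

theorem LabelsOK.toList (l : Option ℕ) (nl : ℕ) : LabelsOK l nl l.toList none nl where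
  le := le_rfl
  nodup := by cases l <;> simp
  range t ht := by simp_all
  next := by simp

/-- Consecutive subprograms draw fresh labels from disjoint intervals, and an incoming label lies
below `nl`. The label handed on is reserved but not yet placed, so the successor can place it
without a clash. -/
theorem compileCore_labels {c : Cmd Lock Var Val} {C l nl Q l' nl' C'}
    (h : compileCore S ra C l nl c = (Q, l', nl', C', false)) (hl : ∀ t, l = some t → t < nl) :
    LabelsOK l nl (annLabels Q) l' nl' := by
  induction c generalizing C l nl Q l' nl' C' with
  | halt => simp [compileCore] at h
  | seq c₁ c₂ ih₁ ih₂ =>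
    obtain ⟨Q₁, l₁, nl₁, C₁, Q₂, h₁, h₂, rfl⟩ := compileCore_seq h
    obtain ⟨a₁, b₁, c₁, d₁⟩ := ih₁ h₁ hl
    obtain ⟨a₂, b₂, c₂, d₂⟩ := ih₂ h₂ fun t ht => (d₁ t ht).2.1
    rw [annLabels_append]
    refine ⟨a₁.trans a₂, List.nodup_append.2 ⟨b₁, b₂, ?_⟩, ?_, ?_⟩
    · grind
    · grind
    · grind
  | ite e c₁ c₂ ih₁ ih₂ =>
    obtain ⟨Qe, r, C₁, Q₁, l₁, nl₁, C₂, Q₂, l₂, C₃, he, h₁, h₂, rfl, rfl, -⟩ := compileCore_ite h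
    obtain ⟨a₁, b₁, c₁, d₁⟩ := ih₁ h₁ (by simp)
    obtain ⟨a₂, b₂, c₂, d₂⟩ := ih₂ h₂ (by grind)
    rw [annLabels_append, annLabels_append, annLabels_append, annLabels_append,
      (compileExpr_headLabelled he).annLabels_snoc]
    simp only [annLabels_cons, annLabels_nil, List.append_nil]
    generalize annLabels Q₁ = L₁ at *
    generalize annLabels Q₂ = L₂ at *
    clear he h₁ h₂ h ih₁ ih₂
    refine ⟨by omega, ?_, ?_, ?_⟩
    · cases l <;> cases l₁ <;> cases l₂ <;> simp [List.nodup_append] <;> grind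
    · cases l <;> cases l₁ <;> cases l₂ <;> simp <;> grind
    · cases l <;> cases l₁ <;> cases l₂ <;> simp <;> grind
  | whileDo e c ih =>
    obtain ⟨lp, ex, Qe, r, Q₁, l₁, C₂, hlp, hex, he, h₁, rfl, rfl⟩ := compileCore_whileDo h
    obtain ⟨a₁, b₁, c₁, d₁⟩ := ih h₁ (by simp)
    rw [annLabels_append, annLabels_append, (compileExpr_headLabelled he).annLabels_snoc]
    simp only [annLabels_cons, annLabels_nil, List.append_nil]
    generalize annLabels Q₁ = L₁ at *
    clear he h₁ h ih
    refine ⟨by grind, ?_, ?_, ?_⟩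
    · cases l <;> cases l₁ <;> simp [List.nodup_append] at * <;> grind
    · cases l <;> cases l₁ <;> simp at * <;> grind
    · cases l <;> cases l₁ <;> simp at * <;> grind
  | assign v e =>
    obtain ⟨Qe, r, C₁, he, rfl, rfl, rfl, -⟩ := compileCore_assign h
    rw [(compileExpr_headLabelled he).annLabels_snoc]
    exact .toList _ _
  | _ =>
    simp only [compileCore, Prod.mk.injEq] at h
    obtain ⟨rfl, rfl, rfl, _⟩ := h
    simpa using LabelsOK.toList l nl

theorem resolve_of_codeAt {P : List (Instr Lock Var Val Reg)} (hP : (P.filterMap Prod.fst).Nodup)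
    {pc t : ℕ} {Q : List (AnnInstr Lock Var Val Reg)} (hQ : CodeAt P pc Q)
    (ht : ∃ a Q', Q = a :: Q' ∧ a.1.1 = some t) : resolve P t = pc := by
  obtain ⟨⟨⟨l, b⟩, C⟩, Q', rfl, rfl⟩ := ht
  exact resolve_eq_of_getElem? hP hQ.1

/-- Jumps are resolved in the whole text, so `P` stays fixed and the code is a fragment of it at
`pc`. The hypothesis `hl'` lets exit jumps reach the end of the fragment. The claim on assumption
records is carried along because the static checks of a later command refer to `asmAfter`, not to
the compiler's own record. -/
theorem compileCore_refines {P : List (Instr Lock Var Val Reg)}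
    (hP : (P.filterMap Prod.fst).Nodup) {c : Cmd Lock Var Val} {C l nl Q l' nl' C'}
    (h : compileCore S ra C l nl c = (Q, l', nl', C', false)) (hc : asmChecks S c C.2)
    {pc : ℕ} (hQ : CodeAt P pc Q) (hl' : ∀ t, l' = some t → resolve P t = pc + Q.length) :
    Refines S P (pc, C) c (pc + Q.length, C') ∧ C'.2 = asmAfter S c C.2 := by
  induction c generalizing C l nl Q l' nl' C' pc with
  | halt => simp [compileCore] at h
  | skip =>
    simp only [compileCore, Prod.mk.injEq] at h
    obtain ⟨rfl, -, -, rfl, -⟩ := h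
    exact ⟨.skip _ _ _ hQ.1, rfl⟩
  | seq c₁ c₂ ih₁ ih₂ =>
    obtain ⟨Q₁, l₁, nl₁, C₁, Q₂, h₁, h₂, rfl⟩ := compileCore_seq h
    obtain ⟨hQ₁, hQ₂⟩ := codeAt_append.1 hQ
    obtain ⟨r₁, e₁⟩ := ih₁ h₁ hc.1 hQ₁ fun t ht => resolve_of_codeAt hP hQ₂ (compileCore_head h₂ ht)
    rw [List.length_append, ← Nat.add_assoc] at hl' ⊢
    obtain ⟨r₂, e₂⟩ := ih₂ h₂ (e₁ ▸ hc.2) hQ₂ hl'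
    exact ⟨.seq _ _ _ _ _ r₁ r₂, by rw [e₂, e₁]; rfl⟩
  | ite e c₁ c₂ ih₁ ih₂ =>
    obtain ⟨Qe, r, C₁, Q₁, l₁, nl₁, C₂, Q₂, l₂, C₃, he, h₁, h₂, rfl, rfl, rfl⟩ := compileCore_ite h
    obtain ⟨hce, hc₁, hc₂, hasm⟩ := hc
    obtain ⟨hC₁, -, hr, -⟩ := compileExpr_record he
    simp only [codeAt_append, List.length_append, List.length_cons, List.length_nil, zero_add,
      ← Nat.add_assoc, Option.some.injEq, forall_eq'] at hQ hl' ⊢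
    obtain ⟨⟨⟨⟨⟨hQe, hjz⟩, hQ₁⟩, hjmp⟩, hQ₂⟩, hnop⟩ := hQ
    obtain ⟨r₁, e₁⟩ := ih₁ h₁ (hC₁ ▸ hc₁) hQ₁ fun t ht =>
      resolve_of_codeAt hP hjmp ⟨_, _, rfl, ht⟩
    obtain ⟨r₂, e₂⟩ := ih₂ h₂ (hC₁ ▸ hc₂) hQ₂ fun t ht =>
      resolve_of_codeAt hP hnop ⟨_, _, rfl, ht⟩
    rw [hC₁] at e₁ e₂
    have hbr := resolve_of_codeAt hP hQ₂ (compileCore_head h₂ rfl)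
    have s₁ := Stutter.jmp (S := S) _ C₂ _ _ hjmp.1
    rw [hl'] at s₁
    have s₂ := Stutter.nop (S := S) _ C₃ _ hnop.1
    refine ⟨Refines.stutters (compileExpr_stutters he hce hQe)
      (.ite _ _ _ _ _ _ _ _ _ hjz.1 hr (.post _ _ _ _ r₁ (.stutter _ _ _ _ s₁ ?_))
        (hbr.symm ▸ .post _ _ _ _ r₂ (.stutter _ _ _ _ s₂ ?_))), e₁⟩
    · exact .weaken _ _ (RegRec.meet C₂.1 C₃.1, C₂.2) _ _ ⟨fun r e h => (RegRec.eq_some_of_meet h).1, rfl⟩ (.done _)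
    · exact .weaken _ _ (RegRec.meet C₂.1 C₃.1, C₂.2) _ _
        -- The final assumptions are those of the first branch; the static check makes them also
        -- those of the second.
        ⟨fun r e h => (RegRec.eq_some_of_meet h).2, (e₁.trans hasm).trans e₂.symm⟩ (.done _)
  | whileDo e c ih =>
    obtain ⟨lp, ex, Qe, r, Q₁, l₁, C₂, -, -, he, h₁, rfl, rfl⟩ := compileCore_whileDo h
    obtain ⟨hce, hc, hasm⟩ := hc
    obtain ⟨hC₁, -, hr, -⟩ := compileExpr_record he
    simp only at hC₁
    -- The head label stands on the first instruction of the loop, whether this belongs to the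
    -- condition or is the conditional jump.
    have hlp : resolve P lp = pc := by
      obtain ⟨a, Q', hQ', ha⟩ := (compileExpr_headLabelled he).head_snoc (.jz ex r) C'
      refine resolve_of_codeAt hP hQ ⟨a, Q' ++ (Q₁ ++ [((l₁, .jmp lp), C₂)]), ?_, ha⟩
      rw [hQ', List.append_assoc, ← List.cons_append]
    simp only [codeAt_append, List.length_append, List.length_cons, List.length_nil, zero_add,
      ← Nat.add_assoc, Option.some.injEq, forall_eq'] at hQ hl' ⊢
    obtain ⟨⟨⟨hQe, hjz⟩, hQ₁⟩, hjmp⟩ := hQ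
    obtain ⟨r₁, e₁⟩ := ih h₁ (hC₁ ▸ hc) hQ₁ fun t ht =>
      resolve_of_codeAt hP hjmp ⟨_, _, rfl, ht⟩
    rw [hC₁, hasm] at e₁
    have s₁ := Stutter.jmp (S := S) _ C₂ _ _ hjmp.1
    rw [hlp] at s₁
    -- The loop is left only through the exit label, which resolves to the end of the fragment.
    rw [← hl']
    exact ⟨.whileDo _ _ _ _ _ _ _ _ _ _ _ (compileExpr_stutters he hce hQe) hjz.1 hr r₁ s₁ e₁, hC₁⟩
  | assign v e =>
    obtain ⟨Qe, r, C₁, he, rfl, rfl, rfl, rfl⟩ := compileCore_assign h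
    obtain ⟨hC₁, -, hr, -⟩ := compileExpr_record he
    obtain ⟨hQe, hst⟩ := codeAt_append.1 hQ
    rw [List.length_append, ← Nat.add_assoc]
    exact ⟨Refines.stutters (compileExpr_stutters he hc.1 hQe) (.assign _ _ _ _ _ _ hst.1 hr), hC₁⟩
  | lockAcq k =>
    simp only [compileCore, Prod.mk.injEq] at h
    obtain ⟨rfl, -, -, rfl, -⟩ := h
    exact ⟨.lockAcq _ _ _ _ hQ.1, rfl⟩
  | lockRel k =>
    simp only [compileCore, Prod.mk.injEq] at h
    obtain ⟨rfl, -, -, rfl, -⟩ := h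
    exact ⟨.lockRel _ _ _ _ hQ.1, rfl⟩

/-- A compiled program refines its source. -/
theorem compileCmd_refines {c : Cmd Lock Var Val} {C l nl Q l' nl' C'}
    (h : compileCmd S ra C l nl c = (Q, l', nl', C', false)) :
    Refines S (Q.map Prod.fst) (0, C) c ((Q.map Prod.fst).length, C') := by
  rcases hcore : compileCore S ra C l nl c with ⟨Q₁, l₁, nl₁, C₁, f₁⟩
  simp only [compileCmd, hcore, Prod.mk.injEq, Bool.or_eq_false_iff, Bool.not_eq_false',
    decide_eq_true_eq] at h
  obtain ⟨rfl, rfl, rfl, rfl, rfl, hreq, -, -, hl⟩ := h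
  have hlab := compileCore_labels hcore hl
  have hQ : (Q₁.map Prod.fst).filterMap Prod.fst = annLabels Q₁ := List.filterMap_map
  have := compileCore_refines (P := Q₁.map Prod.fst) (hQ ▸ hlab.nodup) hcore hreq (codeAt_self Q₁)
    fun t ht => by
      -- No instruction of the complete program carries the last exit label, so it resolves to the
      -- end of the text, as required.
      rw [resolve_eq_length (hQ ▸ (hlab.next t ht).2.2)]
      simp
  simpa using this.1

end CompilerCorrectness

/-! ### The invariant of the concurrent system -/

section System

variable {Lock Var Val Reg : Type*} {S : Setup Lock Var Val}

theorem not_writable_heldMds {H : Set Lock} {x : Lock ⊕ Var} (h : ¬ Writable (heldMds S H) x) :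
    ∃ v k, x = Sum.inr v ∧ k ∈ H ∧ v ∈ S.noW k ∪ S.noRW k := by
  rw [Writable, not_and_or, not_not, not_not] at h
  rcases h with ⟨v, ⟨k, hk, hv⟩, rfl⟩ | ⟨v, ⟨k, hk, hv⟩, rfl⟩
  · exact ⟨v, k, rfl, hk, Or.inl hv⟩
  · exact ⟨v, k, rfl, hk, Or.inr hv⟩

/-- Locks control nothing, and being constantly low they are controlled by nothing. -/
theorem Setup.WellFormed.exists_inr_of_mem_cvars (hS : S.WellFormed) {x y : Lock ⊕ Var}
    (h : y ∈ Cvars S.dma x) : ∃ c v, y = Sum.inr c ∧ x = Sum.inr v := by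
  rcases y with k | c
  · exact absurd ⟨x, h⟩ (hS.lock_not_control k)
  · rcases x with k | v
    · obtain ⟨mem, n, hne⟩ := h
      exact absurd ((hS.lock_low k _).trans (hS.lock_low k _).symm) hne
    · exact ⟨c, v, rfl, rfl⟩

/-- The variables that threads other than `i` hold for exclusive reading and writing. -/
def foreign (S : Setup Lock Var Val) (H : ℕ → Set Lock) (i : ℕ) : Set (Lock ⊕ Var) :=
  {x | ∃ m, m ≠ i ∧ ∃ k ∈ H m, ∃ v ∈ S.noRW k, x = Sum.inr v}

theorem foreign_update (H : ℕ → Set Lock) (i : ℕ) (H' : Set Lock) :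
    foreign S (Function.update H i H') i = foreign S H i := by
  ext x
  constructor <;>
  · rintro ⟨m, hm, k, hk, hx⟩
    refine ⟨m, hm, k, ?_, hx⟩
    simpa [Function.update_of_ne hm] using hk

theorem not_readable_iff {H : Set Lock} {x : Lock ⊕ Var} :
    ¬ Readable (heldMds S H) x ↔ ∃ k ∈ H, ∃ v ∈ S.noRW k, x = Sum.inr v := by
  simp only [Readable, heldMds, not_not, Set.mem_image, Set.mem_ofPred_eq]
  constructor
  · rintro ⟨v, ⟨k, hk, hv⟩, rfl⟩
    exact ⟨k, hk, v, hv, rfl⟩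
  · rintro ⟨k, hk, v, hv, rfl⟩
    exact ⟨v, ⟨k, hk, hv⟩, rfl⟩

/-- A variable and its control variables are governed exclusively by the same locks. An override on
the foreign variables thus takes all the data that classify a given variable from a single memory.
-/
theorem Setup.WellFormed.mem_foreign_cvars (hS : S.WellFormed) {H : ℕ → Set Lock} {i : ℕ}
    {x y : Lock ⊕ Var} (h : y ∈ Cvars S.dma x) : y ∈ foreign S H i ↔ x ∈ foreign S H i := by
  obtain ⟨c, v, rfl, rfl⟩ := hS.exists_inr_of_mem_cvars h
  have := fun k => (hS.control_same_lock c v k h).2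
  simp [foreign, this]

theorem Setup.WellFormed.dma_override_of_mem [Finite Lock] [Finite Var] (hS : S.WellFormed)
    {H : ℕ → Set Lock} {i : ℕ} {x : Lock ⊕ Var} (hx : x ∈ foreign S H i)
    (g mem : Lock ⊕ Var → Val) : S.dma (override (foreign S H i) g mem) x = S.dma g x :=
  dma_congr fun _ hy => override_of_mem ((hS.mem_foreign_cvars hy).2 hx)

theorem Setup.WellFormed.dma_override_of_notMem [Finite Lock] [Finite Var] (hS : S.WellFormed)
    {H : ℕ → Set Lock} {i : ℕ} {x : Lock ⊕ Var} (hx : x ∉ foreign S H i)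
    (g mem : Lock ⊕ Var → Val) : S.dma (override (foreign S H i) g mem) x = S.dma mem x :=
  dma_congr fun _ hy => override_of_notMem (mt (hS.mem_foreign_cvars hy).1 hx)

/-- A thread leaves alone the variables that are governed by a lock it does not hold. -/
theorem LocalModeUse.untouched [Finite Lock] [Finite Var] {H : Set Lock}
    {c c' : Cmd Lock Var Val} {mem₀ mem mem' : Lock ⊕ Var → Val} {mds' : Mds (Lock ⊕ Var)}
    (hc : LocalModeUse S.dma (EvalWhile S) ⟨c, heldMds S H, mem₀⟩)
    (h : EvalWhile S ⟨c, heldMds S H, mem⟩ ⟨c', mds', mem'⟩) {k : Lock} (hk : k ∉ H) {v : Var}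
    (hv : v ∈ S.noW k ∪ S.noRW k) :
    mem (Sum.inr v) = mem' (Sum.inr v) ∧ S.dma mem (Sum.inr v) = S.dma mem' (Sum.inr v) := by
  obtain ⟨hrw, hw⟩ := hc _ .refl (Sum.inr v)
  rcases hv with hv | hv
  · exact hw ⟨v, ⟨k, hk, hv⟩, rfl⟩ _ _ _ _ _ h
  · exact (hrw ⟨v, ⟨k, hk, hv⟩, rfl⟩).doesntW (fun _ _ _ h h' => h.det h') _ _ _ _ _ h

/-- Views of the two memories that differ from them only on the variables in `U` are related by a
strong low bisimulation without high branching. -/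
def Bisimilar (S : Setup Lock Var Val) (H : Set Lock) (U : Set (Lock ⊕ Var))
    (c : Cmd Lock Var Val) (mem₁ mem₂ : Lock ⊕ Var → Val) : Prop :=
  ∃ B view₁ view₂, StrongLowBisimMM S.dma (EvalWhile S) B ∧ NoHighBranching B ∧
    B ⟨c, heldMds S H, view₁⟩ ⟨c, heldMds S H, view₂⟩ ∧
    (∀ x ∉ U, view₁ x = mem₁ x) ∧ ∀ x ∉ U, view₂ x = mem₂ x

/-- The invariant on two runs of a system of source threads that execute the same commands `c` and
hold the same locks `H`. -/
structure SourceInv (S : Setup Lock Var Val) (n : ℕ) (c : ℕ → Cmd Lock Var Val)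
    (H : ℕ → Set Lock) (mem₁ mem₂ : Lock ⊕ Var → Val) : Prop where
  disjoint : ∀ i j k, k ∈ H i → k ∈ H j → i = j
  none_held : ∀ i, n ≤ i → H i = ∅
  locked : ∀ i, ∀ k ∈ H i, S.evLock (mem₁ (Sum.inl k))
  lowEq : ∀ x, x ∈ Cset S.dma ∨
    (S.dma mem₁ x = Sec.low ∧ ∀ i, Readable (heldMds S (H i)) x) → mem₁ x = mem₂ x
  modeUse : ∀ i < n, LocalModeUse S.dma (EvalWhile S) ⟨c i, heldMds S (H i), mem₁⟩
  bisim : ∀ i < n, Bisimilar S (H i) (foreign S H i) (c i) mem₁ mem₂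

namespace SourceInv

variable {n : ℕ} {c : ℕ → Cmd Lock Var Val} {H : ℕ → Set Lock} {mem₁ mem₂ : Lock ⊕ Var → Val}

/-- Thread `i` holds the only lock that governs `x`, and nobody else holds that lock. -/
theorem notMem_foreign (hS : S.WellFormed) (h : SourceInv S n c H mem₁ mem₂) {i : ℕ}
    {x : Lock ⊕ Var} (hx : ¬ Writable (heldMds S (H i)) x) : x ∉ foreign S H i := by
  obtain ⟨v, k, rfl, hk, hv⟩ := not_writable_heldMds hx
  rintro ⟨m, hm, k', hk', w, hw, hvw⟩
  cases hvw
  obtain rfl := hS.managed_once v k k' hv (Or.inr hw)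
  exact hm (h.disjoint m i _ hk' hk)

/-- The ban on high branching compares the views; on variables that others cannot write, the views
show the actual values. -/
theorem cond_eq (hS : S.WellFormed) (h : SourceInv S n c H mem₁ mem₂) {i : ℕ} (hi : i < n)
    {e : Exp Var Val} {c₁ c₂ : Cmd Lock Var Val} (hc : (c i).leftmost = .ite e c₁ c₂)
    (he : ∀ v ∈ e.vars, ¬ Writable (heldMds S (H i)) (Sum.inr v)) : e.ev mem₁ = e.ev mem₂ := by
  obtain ⟨B, view₁, view₂, -, hB, hv, hv₁, hv₂⟩ := h.bisim i hi
  have h₁ : e.ev view₁ = e.ev mem₁ :=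
    Exp.ev_congr fun v hv => hv₁ _ (h.notMem_foreign hS (he v hv))
  have h₂ : e.ev view₂ = e.ev mem₂ :=
    Exp.ev_congr fun v hv => hv₂ _ (h.notMem_foreign hS (he v hv))
  rw [← h₁, ← h₂]
  exact (hB _ _ _ _ _ hv).2 _ _ _ hc

theorem silent (h : SourceInv S n c H mem₁ mem₂) (j : ℕ) {c' : Cmd Lock Var Val}
    (hc : Silent S (c j) c') : SourceInv S n (Function.update c j c') H mem₁ mem₂ where
  disjoint := h.disjoint
  none_held := h.none_held
  locked := h.locked
  lowEq := h.lowEq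
  modeUse i hi := by
    by_cases hij : i = j
    · subst hij
      rw [Function.update_self]
      exact (h.modeUse i hi).of_reach (.step .refl (hc _ _))
    · rw [Function.update_of_ne hij]
      exact h.modeUse i hi
  bisim i hi := by
    by_cases hij : i = j
    · subst hij
      rw [Function.update_self]
      obtain ⟨B, view₁, view₂, hB, hN, hv, hv₁, hv₂⟩ := h.bisim i hi
      obtain ⟨lc, hlc, -, hBlc⟩ := (hB.2.2 _ _ ⟨hv, rfl⟩).2 _ (hc _ _)
      -- The matching step is the silent step itself, so neither view changes.
      obtain rfl := hlc.det (hc _ _)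
      exact ⟨B, view₁, view₂, hB, hN, hBlc, hv₁, hv₂⟩
    · rw [Function.update_of_ne hij]
      exact h.bisim i hi

theorem silents (h : SourceInv S n c H mem₁ mem₂) (j : ℕ) {c' : Cmd Lock Var Val}
    (hc : Relation.ReflTransGen (Silent S) (c j) c') :
    SourceInv S n (Function.update c j c') H mem₁ mem₂ := by
  induction hc with
  | refl => rwa [Function.update_eq_self]
  | @tail c₁ c₂ _ hs ih => simpa using ih.silent j (c' := c₂) (by simpa using hs)

/-- A source step of one thread in the first run is matched in the second run. -/
theorem step [Finite Lock] [Finite Var] (hS : S.WellFormed) (h : SourceInv S n c H mem₁ mem₂)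
    {j : ℕ} (hj : j < n) {c' : Cmd Lock Var Val} {mds' : Mds (Lock ⊕ Var)}
    {mem₁' : Lock ⊕ Var → Val}
    (hstep₁ : EvalWhile S ⟨c j, heldMds S (H j), mem₁⟩ ⟨c', mds', mem₁'⟩) :
    ∃ H' mem₂', mds' = heldMds S H' ∧
      EvalWhile S ⟨c j, heldMds S (H j), mem₂⟩ ⟨c', mds', mem₂'⟩ ∧
      SourceInv S n (Function.update c j c') (Function.update H j H') mem₁' mem₂' ∧
      ∀ i ≠ j, ∀ x, ¬ Writable (heldMds S (H i)) x → mem₁ x = mem₁' x ∧ mem₂ x = mem₂' x := by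
  obtain ⟨H', rfl, hH₁, hH₂, hH₃⟩ := hstep₁.locks hS rfl
  simp only at hH₁ hH₂ hH₃
  obtain ⟨B, view₁, view₂, hB, hN, hv, hv₁, hv₂⟩ := h.bisim j hj
  have hmode := h.modeUse j hj
  have hU : ∀ x ∈ foreign S H j, DoesntRW S.dma (EvalWhile S) (c j) x := by
    rintro x ⟨m, hm, k, hk, v, hv, rfl⟩
    exact (hmode _ .refl _).1 ⟨v, ⟨k, fun hk' => hm (h.disjoint m j k hk hk'), hv⟩, rfl⟩
  -- The actual step is carried over to the first view, matched by the bisimulation in the second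
  -- view, and carried back to the second memory.
  have hview₁ := DoesntRW.override _ hU hstep₁ view₁
  rw [override_eq_self hv₁] at hview₁
  obtain ⟨⟨c'', mds'', view₂'⟩, hview₂, hmds, hB'⟩ := (hB.2.2 _ _ ⟨hv, rfl⟩).2 _ hview₁
  simp only at hmds
  subst hmds
  obtain rfl := (hN _ _ _ _ _ hB').1
  have hstep₂ := DoesntRW.override _ hU hview₂ mem₂
  rw [override_eq_self fun x hx => (hv₂ x hx).symm] at hstep₂
  set view₁' := override (foreign S H j) view₁ mem₁' with hview₁'
  set mem₂' := override (foreign S H j) mem₂ view₂' with hmem₂'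
  have hlow := (hB.2.2 _ _ ⟨hB', rfl⟩).1
  simp only at hlow
  -- variables governed by locks of other threads
  have untouched : ∀ m ≠ j, ∀ k ∈ H m, ∀ v ∈ S.noW k ∪ S.noRW k,
      mem₁ (Sum.inr v) = mem₁' (Sum.inr v) ∧
      S.dma mem₁ (Sum.inr v) = S.dma mem₁' (Sum.inr v) ∧
      mem₂ (Sum.inr v) = mem₂' (Sum.inr v) := by
    intro m hm k hk v hv
    have hk' : k ∉ H j := fun hk' => hm (h.disjoint m j k hk hk')
    exact ⟨(hmode.untouched hstep₁ hk' hv).1, (hmode.untouched hstep₁ hk' hv).2,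
      (hmode.untouched hstep₂ hk' hv).1⟩
  have hdisj : ∀ i j₁ k, k ∈ Function.update H j H' i → k ∈ Function.update H j H' j₁ →
      i = j₁ := by
    -- A newly acquired lock was free in memory, whereas a lock held by another thread is marked as
    -- taken.
    have key : ∀ i ≠ j, ∀ k ∈ H i, k ∉ H' := fun i hi k hk hk' =>
      (hH₁ k hk').elim (fun hk'' => hi (h.disjoint i j k hk hk'')) fun hn => hn (h.locked i k hk)
    intro i₁ i₂ k h₁ h₂
    by_cases e₁ : i₁ = j <;> by_cases e₂ : i₂ = j
    · rw [e₁, e₂]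
    · subst e₁
      rw [Function.update_self] at h₁
      rw [Function.update_of_ne e₂] at h₂
      exact absurd h₁ (key _ e₂ _ h₂)
    · subst e₂
      rw [Function.update_self] at h₂
      rw [Function.update_of_ne e₁] at h₁
      exact absurd h₂ (key _ e₁ _ h₁)
    · rw [Function.update_of_ne e₁] at h₁
      rw [Function.update_of_ne e₂] at h₂
      exact h.disjoint _ _ _ h₁ h₂
  have hlowEq : ∀ x, x ∈ Cset S.dma ∨ (S.dma mem₁' x = Sec.low ∧
      ∀ i, Readable (heldMds S (Function.update H j H' i)) x) → mem₁' x = mem₂' x := by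
    intro x hx
    by_cases hxU : x ∈ foreign S H j
    · obtain ⟨m, hm, k, hk, v, hv, rfl⟩ := hxU
      rcases hx with hx | ⟨-, hx⟩
      · obtain ⟨u₁, -, u₂⟩ := untouched m hm k hk v (Or.inr hv)
        rw [← u₁, ← u₂]
        exact h.lowEq _ (Or.inl hx)
      · have := hx m
        rw [Function.update_of_ne hm] at this
        exact absurd this (not_readable_iff.2 ⟨k, hk, v, hv, rfl⟩)
    -- Off the foreign variables the new views of `j` are the new memories, and the bisimulation
    -- makes them low-equal. This covers the variables that `j` may just have released.
    · have := hlow x <| hx.imp_right fun ⟨h₁, h₂⟩ => by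
        refine ⟨by rwa [hview₁', hS.dma_override_of_notMem hxU], ?_⟩
        simpa using h₂ j
      rw [hview₁', override_of_notMem hxU] at this
      exact this.trans (override_of_notMem hxU).symm
  refine ⟨H', mem₂', rfl, hstep₂, ⟨hdisj, ?_, ?_, hlowEq, ?_, ?_⟩, ?_⟩
  · intro i hi
    rw [Function.update_of_ne (by omega)]
    exact h.none_held i hi
  · intro i k hk
    by_cases hij : i = j
    · subst hij
      rw [Function.update_self] at hk
      exact hH₂ k hk (h.locked i k)
    · rw [Function.update_of_ne hij] at hk
      exact hH₃ k (fun hk' => hij (h.disjoint _ _ _ hk hk')) (h.locked i k hk)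
  · intro i hi
    by_cases hij : i = j
    · subst hij
      rw [Function.update_self, Function.update_self]
      exact hmode.of_reach (.step .refl hstep₁)
    · rw [Function.update_of_ne hij, Function.update_of_ne hij]
      refine (h.modeUse i hi).of_reach (.memDiff .refl fun x hx => ?_)
      by_contra hw
      obtain ⟨v, k, rfl, hk, hv⟩ := not_writable_heldMds hw
      obtain ⟨u₁, u₂, -⟩ := untouched i hij k hk v hv
      exact hx.elim (· u₁) (· u₂)
  · intro i hi
    by_cases hij : i = j
    · subst hij
      rw [Function.update_self, Function.update_self, foreign_update]
      exact ⟨B, view₁', view₂', hB, hN, hB', fun x hx => override_of_notMem hx,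
        fun x hx => (override_of_notMem hx).symm⟩
    · rw [Function.update_of_ne hij, Function.update_of_ne hij]
      clear_value view₁' mem₂'
      clear hB' hlow hview₁ hview₂ hv hv₁ hv₂ hN hB
      obtain ⟨B, w₁, w₂, hB, hN, hw, hw₁, hw₂⟩ := h.bisim i hi
      have hwlow := (hB.2.2 _ _ ⟨hw, rfl⟩).1
      simp only at hwlow
      -- The new views of a waiting thread keep the old view on what is foreign now and are
      -- refreshed from memory elsewhere.
      refine ⟨B, override (foreign S (Function.update H j H') i) w₁ mem₁',
        override (foreign S (Function.update H j H') i) w₂ mem₂', hB, hN, ?_,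
        fun x hx => override_of_notMem hx, fun x hx => override_of_notMem hx⟩
      -- Closure under globally consistent changes: variables that `i` protects were left alone by
      -- `j`, and low-equality comes from the old views on foreign variables and from the memories
      -- elsewhere.
      refine hB.1 _ _ _ _ _ hw _ _ ⟨fun x hx => ?_, fun x hx => ?_⟩
      · by_contra hwr
        have hxU := h.notMem_foreign hS hwr
        obtain ⟨v, k, rfl, hk, hv⟩ := not_writable_heldMds hwr
        have hxU' : Sum.inr v ∉ foreign S (Function.update H j H') i := by
          rintro ⟨m, hm, k', hk', w, hw, hvw⟩
          cases hvw
          obtain rfl := hS.managed_once v k k' hv (Or.inr hw)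
          exact hm (hdisj m i _ hk' (by rwa [Function.update_of_ne hij]))
        obtain ⟨u₁, u₂, u₃⟩ := untouched i hij k hk v hv
        rw [override_of_notMem hxU', override_of_notMem hxU', hS.dma_override_of_notMem hxU',
          hw₁ _ hxU, hw₂ _ hxU] at hx
        refine hx.elim (· u₁) (Or.elim · (· u₃) (· ?_))
        rw [← override_eq_self hw₁, hS.dma_override_of_notMem hxU, u₂]
      · by_cases hxU : x ∈ foreign S (Function.update H j H') i
        · rw [hS.dma_override_of_mem hxU] at hx
          rw [override_of_mem hxU, override_of_mem hxU]
          exact hwlow x hx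
        · rw [hS.dma_override_of_notMem hxU] at hx
          rw [override_of_notMem hxU, override_of_notMem hxU]
          refine hlowEq x (hx.imp_right fun ⟨h₁, h₂⟩ => ⟨h₁, fun m => ?_⟩)
          by_cases hm : m = i
          · subst hm
            rwa [Function.update_of_ne hij]
          · by_contra hr
            exact hxU ⟨m, hm, not_readable_iff.1 hr⟩
  · intro i hij x hx
    obtain ⟨v, k, rfl, hk, hv⟩ := not_writable_heldMds hx
    obtain ⟨u₁, -, u₃⟩ := untouched i hij k hk v hv
    exact ⟨u₁, u₃⟩

end SourceInv

/-- The invariant on two runs of a system of target threads. -/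
def SystemInv (S : Setup Lock Var Val) (gc₁ gc₂ : GlobalConf (RiscState Lock Var Val Reg)
    (Lock ⊕ Var) Val) : Prop :=
  gc₁.1.length = gc₂.1.length ∧ ∃ c H, SourceInv S gc₁.1.length c H gc₁.2 gc₂.2 ∧
    ∀ i < gc₁.1.length, ∃ P pc C C' regs₁ regs₂,
      gc₁.1[i]? = some (((pc, P), regs₁), heldMds S (H i)) ∧
      gc₂.1[i]? = some (((pc, P), regs₂), heldMds S (H i)) ∧
      Refines S P (pc, C) (c i) (P.length, C') ∧
      RecordHolds S C (heldMds S (H i)) regs₁ gc₁.2 ∧ RecordHolds S C (heldMds S (H i)) regs₂ gc₂.2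

theorem EvalRisc.pc_lt {P : List (Instr Lock Var Val Reg)} {pc : ℕ} {regs : Reg → Val}
    {mds : Mds (Lock ⊕ Var)} {mem : Lock ⊕ Var → Val}
    {lc : LocalConf (RiscState Lock Var Val Reg) (Lock ⊕ Var) Val}
    (h : EvalRisc S ⟨((pc, P), regs), mds, mem⟩ lc) : pc < P.length := by
  cases h <;> exact (List.getElem?_eq_some_iff.1 ‹_›).1

theorem SystemInv.step [Finite Lock] [Finite Var] (hS : S.WellFormed)
    {gc₁ gc₂ gc₁' : GlobalConf (RiscState Lock Var Val Reg) (Lock ⊕ Var) Val}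
    (h : SystemInv S gc₁ gc₂) {j : ℕ} (hstep : SchedStep (EvalRisc S) j gc₁ gc₁') :
    ∃ gc₂', SchedStep (EvalRisc S) j gc₂ gc₂' ∧ SystemInv S gc₁' gc₂' := by
  obtain ⟨cms₁, mem₁⟩ := gc₁
  obtain ⟨cms₂, mem₂⟩ := gc₂
  obtain ⟨hj, tps', mds', mem₁', heval, rfl⟩ := hstep
  obtain ⟨hlen, c, H, hsrc, hthreads⟩ := h
  simp only at hj heval hlen hsrc hthreads
  obtain ⟨P, pc, C, C', regs₁, regs₂, h₁, h₂, hr, hC₁, hC₂⟩ := hthreads j hj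
  obtain ⟨hj₂, h₂⟩ := List.getElem?_eq_some_iff.1 h₂
  rw [(List.getElem?_eq_some_iff.1 h₁).2] at heval
  simp only at heval
  obtain ⟨c', hsil, hready⟩ := hr.normalize
  -- Only the ghost command moves; the target is still at the same point.
  have hsrc' := hsrc.silents j hsil
  -- the matching step and the preservation of the invariant, from those of thread `j`
  have key : ∀ (c'' : Cmd Lock Var Val) (H' : Set Lock) (mem₁'' mem₂' : Lock ⊕ Var → Val)
      (σ' : Point Var Val Reg) (regs₁' regs₂' : Reg → Val),
      SourceInv S cms₁.length (Function.update c j c'') (Function.update H j H') mem₁'' mem₂' →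
      (∀ i ≠ j, ∀ x, ¬ Writable (heldMds S (H i)) x → mem₁ x = mem₁'' x ∧ mem₂ x = mem₂' x) →
      EvalRisc S ⟨((pc, P), regs₁), heldMds S (H j), mem₁⟩
        ⟨((σ'.1, P), regs₁'), heldMds S H', mem₁''⟩ →
      EvalRisc S ⟨((pc, P), regs₂), heldMds S (H j), mem₂⟩
        ⟨((σ'.1, P), regs₂'), heldMds S H', mem₂'⟩ →
      Refines S P σ' c'' (P.length, C') →
      RecordHolds S σ'.2 (heldMds S H') regs₁' mem₁'' →
      RecordHolds S σ'.2 (heldMds S H') regs₂' mem₂' →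
      ∃ gc₂', SchedStep (EvalRisc S) j (cms₂, mem₂) gc₂' ∧
        SystemInv S (cms₁.set j (tps', mds'), mem₁') gc₂' := by
    intro c'' H' mem₁'' mem₂' σ' regs₁' regs₂' hsrc'' hmem e₁ e₂ hr' hC₁' hC₂'
    have := heval.det e₁
    simp only [LocalConf.mk.injEq] at this
    obtain ⟨rfl, rfl, rfl⟩ := this
    refine ⟨(cms₂.set j (((σ'.1, P), regs₂'), heldMds S H'), mem₂'),
      ⟨hj₂, _, _, _, by simpa only [h₂] using e₂, rfl⟩, by simpa using hlen,
      Function.update c j c'', Function.update H j H', by simpa using hsrc'', ?_⟩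
    intro i hi
    simp only [List.length_set] at hi
    by_cases hij : i = j
    · subst hij
      refine ⟨P, σ'.1, σ'.2, C', regs₁', regs₂', ?_, ?_, ?_⟩
      · simp [hi]
      · simp [hj₂]
      · simp only [Function.update_self]
        exact ⟨hr', hC₁', hC₂'⟩
    · obtain ⟨P, pc, C, C', regs₁, regs₂, h₁, h₂, hr, hC₁, hC₂⟩ := hthreads i hi
      refine ⟨P, pc, C, C', regs₁, regs₂, ?_⟩
      simp only [List.getElem?_set_ne (Ne.symm hij), Function.update_of_ne hij]
      -- The records of waiting threads remain true because thread `j` has not changed what they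
      -- protect from writing.
      exact ⟨h₁, h₂, hr, hC₁.mem_congr fun x hx => (hmem i hij x hx).1,
        hC₂.mem_congr fun x hx => (hmem i hij x hx).2⟩
  cases hready with
  -- When the source has terminated, the counter is at the end of the text, where no step exists.
  | done _ hpc _ => exact absurd heval.pc_lt (by simpa using hpc.ge)
  | stutter C₁ σ' hC hs hr' =>
    obtain ⟨regs₁', e₁, hC₁'⟩ := hs.step (hC₁.weaken hC)
    obtain ⟨regs₂', e₂, hC₂'⟩ := hs.step (hC₂.weaken hC)
    exact key c' (H j) mem₁ mem₂ σ' regs₁' regs₂' (by rwa [Function.update_eq_self])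
      (fun _ _ _ _ => ⟨rfl, rfl⟩) e₁ e₂ hr' hC₁' hC₂'
  | lockstep C₁ hC hl =>
    replace hC₁ := hC₁.weaken hC
    replace hC₂ := hC₂.weaken hC
    obtain ⟨c'', mds'', mem₁'', s₁⟩ := hl.progress (heldMds S (H j)) mem₁
    obtain ⟨H', mem₂', rfl, s₂, hsrc'', hmem⟩ := hsrc'.step hS hj (c' := c'') (mds' := mds'')
      (mem₁' := mem₁'') (by simpa using s₁)
    rw [Function.update_self] at s₂
    obtain ⟨σ', hr', e₁, e₂, hC₁', hC₂'⟩ := hl.steps _ _ _ _ _ _ _ _ _ s₁ s₂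
      (fun e c₁ c₂ hc => hsrc'.cond_eq hS hj (by simpa using hc) fun v hv =>
        hC₁.not_writable (hl.cond_stable hC₁.stable e c₁ c₂ hc v hv)) hC₁ hC₂
    exact key c'' H' mem₁'' mem₂' σ' regs₁ regs₂ (by simpa using hsrc'') hmem e₁ e₂ hr' hC₁' hC₂'

theorem SystemInv.sched [Finite Lock] [Finite Var] (hS : S.WellFormed) {s : List ℕ}
    {gc₁ gc₂ gc₁' : GlobalConf (RiscState Lock Var Val Reg) (Lock ⊕ Var) Val}
    (h : SystemInv S gc₁ gc₂) (hs : EvalSched (EvalRisc S) s gc₁ gc₁') :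
    ∃ gc₂', EvalSched (EvalRisc S) s gc₂ gc₂' ∧ SystemInv S gc₁' gc₂' := by
  induction s generalizing gc₁ gc₂ with
  | nil =>
    obtain rfl : gc₁ = gc₁' := hs
    exact ⟨gc₂, rfl, h⟩
  | cons j s ih =>
    obtain ⟨gc, hj, hs⟩ := hs
    obtain ⟨gc', hj', h'⟩ := h.step hS hj
    obtain ⟨gc₂', hs', h''⟩ := ih h' hs
    exact ⟨gc₂', ⟨gc', hj', hs'⟩, h''⟩

theorem SystemInv.secure
    {gc₁ gc₂ : GlobalConf (RiscState Lock Var Val Reg) (Lock ⊕ Var) Val}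
    (h : SystemInv S gc₁ gc₂) : gc₁.1.length = gc₂.1.length ∧
      gc₁.1.map Prod.snd = gc₂.1.map Prod.snd ∧
      ∀ x, x ∈ Cset S.dma ∨ (S.dma gc₁.2 x = Sec.low ∧ ∀ cm ∈ gc₁.1, Readable cm.2 x) →
        gc₁.2 x = gc₂.2 x := by
  obtain ⟨hlen, c, H, hsrc, hthreads⟩ := h
  refine ⟨hlen, List.ext_getElem? fun i => ?_, fun x hx => ?_⟩
  · rw [List.getElem?_map, List.getElem?_map]
    by_cases hi : i < gc₁.1.length
    · obtain ⟨P, pc, C, C', regs₁, regs₂, h₁, h₂, -⟩ := hthreads i hi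
      rw [h₁, h₂]
      rfl
    · rw [List.getElem?_eq_none (by omega), List.getElem?_eq_none (by omega)]
  · refine hsrc.lowEq x (hx.imp_right fun ⟨h₁, h₂⟩ => ⟨h₁, fun i => ?_⟩)
    by_cases hi : i < gc₁.1.length
    · obtain ⟨P, pc, C, C', regs₁, regs₂, h₁, -⟩ := hthreads i hi
      exact h₂ _ (List.mem_of_getElem? h₁)
    -- The invariant ranges over all natural numbers as thread indices; those beyond the list hold
    -- no locks and restrict nothing.
    · rw [hsrc.none_held i (by omega)]
      simp [Readable, heldMds]

theorem recordHolds_initCompRec (regs : Reg → Val) (mem : Lock ⊕ Var → Val) :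
    RecordHolds S initCompRec (heldMds S ∅) regs mem where
  stable r e he := by simp [initCompRec] at he
  noW v := by simp [initCompRec, heldMds]
  noRW v := by simp [initCompRec, heldMds]
  val r e he := by simp [initCompRec] at he

end System

end Covern

/-! ### The theorem -/

open Covern
theorem mainTheorem1 {Lock Var Val Reg : Type*} [Finite Lock] [Finite Var]
    (S : Setup Lock Var Val) (hS : S.WellFormed) (ra : RegAlloc Var Val Reg)
    (cs : List (Cmd Lock Var Val))
    (cmsr : List (RiscState Lock Var Val Reg × Mds (Lock ⊕ Var)))
    (hlen : cmsr.length = cs.length)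
    (h : ∀ (i : ℕ) (hi : i < cmsr.length),
      ∃ (l : Option ℕ) (nl : ℕ) (PCs : List (AnnInstr Lock Var Val Reg)) (l' : Option ℕ) (nl' : ℕ)
        (C' : CompRec Var Val Reg) (regs : Reg → Val),
        ComSecure S.dma (EvalWhile S) (NoLocksHeld S) NoHighBranching (cs[i], initMds S) ∧
        (∀ mem, NoLocksHeld S mem →
          LocalModeUse S.dma (EvalWhile S) ⟨cs[i], initMds S, mem⟩) ∧
        (PCs, l', nl', C', false) = compileCmd S ra initCompRec l nl cs[i] ∧
        CompilerInputReqs S (initCompRec : CompRec Var Val Reg) l nl cs[i] ∧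
        cmsr[i] = (((0, PCs.map Prod.fst), regs), initMds S)) :
    SysSecure S.dma (EvalRisc S) (NoLocksHeld S) cmsr := by
  rintro mem₁ mem₂ ⟨hinit₁, hinit₂, hlow⟩ s cms₁' mem₁' hs
  have hloweq : ∀ x, x ∈ Cset S.dma ∨ S.dma mem₁ x = Sec.low → mem₁ x = mem₂ x :=
    -- Control variables are always low, so low-equality already covers them.
    fun x hx => hlow x (hx.elim (hS.control_low mem₁ x) id)
  have hinv : SystemInv S (cmsr, mem₁) (cmsr, mem₂) := by
    refine ⟨rfl, fun i => cs.getD i .halt, fun _ => ∅, ⟨by simp, by simp, by simp, ?_, ?_, ?_⟩, ?_⟩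
    · exact fun x hx => hloweq x (hx.imp_right And.left)
    · intro i hi
      obtain ⟨l, nl, PCs, l', nl', C', regs, -, hmode, -⟩ := h i hi
      rw [← initMds_eq_heldMds, List.getD_eq_getElem _ _ (hlen ▸ hi)]
      exact hmode _ hinit₁
    · intro i hi
      obtain ⟨l, nl, PCs, l', nl', C', regs, hsec, -⟩ := h i hi
      rw [Bisimilar, ← initMds_eq_heldMds, List.getD_eq_getElem _ _ (hlen ▸ hi)]
      obtain ⟨B, hB, hN, hBi⟩ := hsec mem₁ mem₂
        ⟨fun x hx => hloweq x (hx.imp_right And.left), hinit₁, hinit₂⟩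
      -- No lock is held at the start, so the memories themselves serve as views.
      exact ⟨B, mem₁, mem₂, hB, hN, hBi, fun _ _ => rfl, fun _ _ => rfl⟩
    · intro i hi
      obtain ⟨l, nl, PCs, l', nl', C', regs, -, -, hcomp, -, hi'⟩ := h i hi
      refine ⟨PCs.map Prod.fst, 0, initCompRec, C', regs, regs, ?_, ?_, ?_,
        recordHolds_initCompRec _ _, recordHolds_initCompRec _ _⟩
      · rw [← initMds_eq_heldMds, ← hi']
        exact List.getElem?_eq_getElem hi
      · rw [← initMds_eq_heldMds, ← hi']
        exact List.getElem?_eq_getElem hi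
      · beta_reduce
        rw [List.getD_eq_getElem _ _ (hlen ▸ hi)]
        exact compileCmd_refines hcomp.symm
  obtain ⟨⟨cms₂', mem₂'⟩, hs₂, hinv'⟩ := hinv.sched hS hs
  refine ⟨⟨_, _, hs₂⟩, fun cms₂'' mem₂'' hs₂' => ?_⟩
  -- By determinism, every second run under this schedule is the one constructed.
  cases hs₂.det (fun _ _ _ h h' => h.det h') hs₂'
  exact hinv'.secure
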